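/- Let $n\ge 0$ and let $S_{2n}$ be the group of permutations of $\{1,\bar 1,\dots,n,\bar n\}$ (with $\bar{\bar\imath}=i$), products being compositions from right to left. Let $H_n=\{\sigma\in S_{2n} : \sigma(\bar x)=\overline{\sigma(x)} \text{ for all } x\}$ be the hyperoctahedral group and $p_n=\sum_{h\in H_n}h\in\mathbb Z[S_{2n}]$. The coset-type of $\sigma\in S_{2n}$ is the partition $\mu$ of $n$ such that the graph on $\{1,\bar 1,\dots,n,\bar n\}$ with, for every $i$, one edge $\{i,\bar\imath\}$ and one edge $\{\sigma(i),\sigma(\bar\imath)\}$ (a disjoint union of even cycles, two parallel edges counting as a cycle of length $2$) has cycles of lengths $2\mu_1,2\mu_2,\dots$. For $\mu\vdash n$ let $\mathcal C^{(2)}_\mu$ be the sum in $\mathbb Z[S_{2n}]$ of all permutations of coset-type $\mu$. For $1\le i\le n$ let \[ J^{(2)}_i=\sum_{j\in\{1,\bar 1,\dots,i-1,\overline{i-1}\}}(j\ i)\in\mathbb Z[S_{2n}] \] be the odd Jucys--Murphy elements, which commute with each other, and let $h_k$ be the complete homogeneous symmetric function of degree $k$. **Proposition.** For all integers $n,k\ge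 0$ there is exactly one family of integers $(b^k_\mu)_{\mu\vdash n}$ such that \[ h_k(J^{(2)}_1,\dots,J^{(2)}_n)\,p_n=\sum_{\mu\vdash n} b^k_\mu\,\mathcal C^{(2)}_\mu . \] Moreover, for every partition $\rho$ of $n$, with $\ell(\rho)$ parts and size $|\rho|=n$: 1. if $|\rho|-\ell(\rho)>k$, then $b^k_\rho=0$; 2. if $|\rho|-\ell(\rho)=k$, then $b^k_\rho=\prod_{i=1}^{\ell(\rho)}\mathrm{Cat}_{\rho_i-1}$, where $\mathrm{Cat}_m=\frac{1}{m+1}\binom{2m}{m}$ is the $m$-th Catalan number. -/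

import Mathlib

namespace OddJM

/-- The `2n` points `1, 1̄, …, n, n̄`: `(i, false)` stands for `i` and `(i, true)` for `ī`. -/
abbrev Pt (n : ℕ) : Type := Fin n × Bool

/-- The involution `i ↦ ī`, `ī ↦ i`. -/
def bar {n : ℕ} (x : Pt n) : Pt n := (x.1, !x.2)

/-- The symmetric group `S_{2n}` of the points; `σ * τ` is `τ` followed by `σ`. -/
abbrev Sym2n (n : ℕ) : Type := Equiv.Perm (Pt n)

/-- The group algebra `ℤ[S_{2n}]`. -/
abbrev GrpAlg (n : ℕ) : Type := MonoidAlgebra ℤ (Sym2n n)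

/-- A permutation as an element of the group algebra. -/
noncomputable abbrev perm {n : ℕ} (σ : Sym2n n) : GrpAlg n := MonoidAlgebra.of ℤ (Sym2n n) σ

/-- The hyperoctahedral group `H_n`: the permutations that commute with the bar involution. -/
def hyperoctahedral (n : ℕ) : Subgroup (Sym2n n) where
  carrier := {σ | ∀ x, σ (bar x) = bar (σ x)}
  mul_mem' := by
    intro a b ha hb x
    simp only [Set.mem_ofPred_eq] at ha hb
    simp [hb, ha]
  one_mem' := by intro x; rfl
  inv_mem' := by
    intro a ha x
    simp only [Set.mem_ofPred_eq] at ha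
    rw [Equiv.Perm.inv_eq_iff_eq, ha]
    simp

/-- The graph `G_σ`: a solid edge between `i` and `ī`, and a dashed edge between `σ(i)` and `σ(ī)`,
for each `i` (the types of the edges being forgotten). -/
def cosetGraph {n : ℕ} (σ : Sym2n n) : SimpleGraph (Pt n) :=
  SimpleGraph.fromRel fun x y => y = bar x ∨ ∃ z, x = σ z ∧ y = σ (bar z)

theorem bar_mem_supp_iff {n : ℕ} (σ : Sym2n n) (c : (cosetGraph σ).ConnectedComponent)
    (x : Pt n) : bar x ∈ c.supp ↔ x ∈ c.supp := by
  have h : (cosetGraph σ).Adj x (bar x) := by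
    rw [cosetGraph, SimpleGraph.fromRel_adj]
    refine ⟨?_, Or.inl (Or.inl rfl)⟩
    intro hx
    have := congrArg Prod.snd hx
    simp [bar] at this
  exact (c.mem_supp_congr_adj h).symm

theorem ncard_supp {n : ℕ} (σ : Sym2n n) (c : (cosetGraph σ).ConnectedComponent) :
    c.supp.ncard = 2 * {i : Fin n | (i, false) ∈ c.supp}.ncard := by
  have h : c.supp = {i : Fin n | (i, false) ∈ c.supp} ×ˢ (Set.univ : Set Bool) := by
    ext ⟨i, b⟩
    have := bar_mem_supp_iff σ c (i, false)
    cases b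
    · simp
    · simpa [bar] using this
  conv_lhs => rw [h]
  rw [Set.ncard_prod, Set.ncard_univ]
  simp [mul_comm]

open scoped Classical in
/-- The coset-type of `σ`: the partition of `n` whose parts are the half-lengths of the cycles of
`G_σ`. Each vertex of `G_σ` has degree `2` (when a solid and a dashed edge join the same two points,
they form a cycle of length `2`), so the cycles are the connected components, and the length of a
cycle is its number of vertices. -/
noncomputable def cosetType {n : ℕ} (σ : Sym2n n) : n.Partition where
  parts := (Finset.univ : Finset (cosetGraph σ).ConnectedComponent).val.map
    fun c => c.supp.ncard / 2
  parts_pos := by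
    intro m hm
    obtain ⟨c, -, rfl⟩ := Multiset.mem_map.1 hm
    rw [ncard_supp σ c, Nat.mul_div_cancel_left _ two_pos]
    obtain ⟨x, hx⟩ := c.nonempty_supp
    refine (Set.ncard_pos).2 ⟨x.1, ?_⟩
    rcases x with ⟨i, b⟩
    cases b
    · exact hx
    · exact (bar_mem_supp_iff σ c (i, true)).2 hx
  parts_sum := by
    change ∑ c : (cosetGraph σ).ConnectedComponent, c.supp.ncard / 2 = n
    have h : ∀ c : (cosetGraph σ).ConnectedComponent, c.supp.ncard / 2 =
        (Finset.univ.filter fun i : Fin n =>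
          (cosetGraph σ).connectedComponentMk (i, false) = c).card := by
      intro c
      rw [ncard_supp σ c, Nat.mul_div_cancel_left _ two_pos, Set.ncard_eq_toFinset_card']
      congr 1
      ext i
      simp
    rw [Finset.sum_congr rfl fun c _ => h c]
    have h' := Finset.card_eq_sum_card_fiberwise (s := (Finset.univ : Finset (Fin n)))
      (t := (Finset.univ : Finset (cosetGraph σ).ConnectedComponent))
      (f := fun i => (cosetGraph σ).connectedComponentMk (i, false)) (by simp)
    rw [Finset.card_univ, Fintype.card_fin] at h'
    refine Eq.trans ?_ h'.symm
    refine Finset.sum_congr rfl fun c _ => ?_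
    congr!

open scoped Classical in
/-- The sum `C_μ` of all permutations of coset-type `μ`. -/
noncomputable def classSum {n : ℕ} (μ : n.Partition) : GrpAlg n :=
  ∑ σ : Sym2n n with cosetType σ = μ, perm σ

open scoped Classical in
/-- The sum `p_n` of the elements of the hyperoctahedral group. -/
noncomputable def pElt (n : ℕ) : GrpAlg n :=
  ∑ σ : Sym2n n with σ ∈ hyperoctahedral n, perm σ

/-- The odd Jucys-Murphy element `J_i`: the sum of the transpositions `(j i)`
over `j = 1, 1̄, …, i-1, (i-1)‾`. -/
noncomputable def oddJucysMurphy {n : ℕ} (i : Fin n) : GrpAlg n :=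
  ∑ j : Pt n with j.1 < i, perm (Equiv.swap j (i, false))

theorem perm_commute_oddJucysMurphy {n : ℕ} (i : Fin n) (τ : Sym2n n)
    (h1 : τ (i, false) = (i, false)) (h2 : ∀ x : Pt n, (τ x).1 < i ↔ x.1 < i) :
    Commute (perm τ) (oddJucysMurphy i) := by
  unfold Commute SemiconjBy oddJucysMurphy
  rw [Finset.mul_sum, Finset.sum_mul]
  refine Finset.sum_equiv τ (by simp [h2]) ?_
  intro j _
  rw [perm, perm, perm, ← map_mul, ← map_mul, Equiv.mul_swap_eq_swap_mul, h1]

/-- The odd Jucys-Murphy elements commute, so that polynomials may be evaluated at them. -/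
theorem oddJucysMurphy_commute {n : ℕ} (i j : Fin n) :
    Commute (oddJucysMurphy i) (oddJucysMurphy j) := by
  have key : ∀ i j : Fin n, i < j → Commute (oddJucysMurphy i) (oddJucysMurphy j) := by
    intro i j hij
    refine Commute.sum_left _ _ _ fun a ha => ?_
    have ha' : a.1 < i := by simpa using ha
    have haj : a.1 < j := ha'.trans hij
    refine perm_commute_oddJucysMurphy j _ ?_ ?_
    · refine Equiv.swap_apply_of_ne_of_ne ?_ ?_
      · rintro rfl
        exact lt_irrefl _ haj
      · intro h
        exact hij.ne' (congrArg Prod.fst h)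
    · intro x
      rw [Equiv.swap_apply_def]
      split_ifs with h h'
      · subst h; exact ⟨fun _ => haj, fun _ => hij⟩
      · subst h'; exact ⟨fun _ => hij, fun _ => haj⟩
      · rfl
  rcases lt_trichotomy i j with h | rfl | h
  · exact key i j h
  · exact Commute.refl _
  · exact (key j i h).symm

open scoped Classical in
/-- The complete homogeneous symmetric function
`h_k(x_1, …, x_n) = ∑_{i_1 ≤ ⋯ ≤ i_k} x_{i_1} ⋯ x_{i_k}` at (commuting) elements `x_i` of a ring. -/
noncomputable def complete {R : Type*} [Ring R] {n : ℕ} (k : ℕ) (x : Fin n → R) : R :=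
  ∑ f : Fin k → Fin n with Monotone f, (List.ofFn fun t => x (f t)).prod

/-- `b` is the family of the coefficients `b^k_μ`, `μ ⊢ n`, of the expansion
`h_k(J_1, …, J_n) p_n = ∑_{μ ⊢ n} b^k_μ C_μ`. -/
def IsClassExpansion (n k : ℕ) (b : n.Partition → ℤ) : Prop :=
  complete k (oddJucysMurphy (n := n)) * pElt n = ∑ μ : n.Partition, b μ • classSum μ

end OddJM

/-! The coset $\sigma H_n$ is recorded by the perfect matching `matching σ`, and the double coset
$H_n\sigma H_n$ by the coset-type. A two-colouring of $G_\sigma$ shows that every double coset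
contains a permutation `levelPerm false w` moving only the unbarred points, and its coset-type is
the cycle type of $w \in S_n$. Transpositions of unbarred points then cut or merge cycles of $w$.
For general $\sigma$ the parts are counted through `matchingProd σ`, which has two cycles for each
part.

Top coefficients: $h_{k+1}(J_1,\dots,J_i) = h_{k+1}(J_1,\dots,J_{i-1}) + J_i\,h_k(J_1,\dots,J_i)$
gives a recursion for the coefficient at $\sigma$. A transposition adds at most one part, so when
$n-\ell \ge k+1$ only those that cut a cycle matter. Cutting a cycle of length $m$ into $i$ and
$m-i$ in all ways is the Catalan recursion (`sum_topCoeff_cosetType_swap_mul`,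
`coeff_completeUpTo`).

Existence of the expansion: the same recursion for elementary functions has at most one surviving
term at each step, so the coefficients of $e_k p_n$ depend only on the coset-type
(`coeff_elemUpTo`). The relation $\sum_j (-1)^j h_{k-j}e_j = 0$ transfers left $H_n$-invariance from
the $e_j p_n$ to $h_k p_n$ (`complete_mul_pElt_mem_leftInvariants`). Right invariance comes from
$p_n$, and since equal coset-types mean equal double cosets, the expansion follows. -/

namespace OddJM

/-! ### Cycle lengths of a permutation multiplied by a transposition -/

section CycleStructure

variable {α : Type*} [DecidableEq α]

open Equiv Equiv.Perm

theorem formPerm_append_cons (l₁ : List α) (b : α) (l₂ : List α) :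
    (l₁ ++ b :: l₂).formPerm = (l₁ ++ [b]).formPerm * (b :: l₂).formPerm := by
  induction l₁ with
  | nil => simp
  | cons x l ih =>
    cases l with
    | nil => simp
    | cons y l =>
      simp only [List.cons_append, List.formPerm_cons_cons] at ih ⊢
      rw [ih, mul_assoc]

/-- Multiplication by the transposition of two points of a cycle cuts the cycle. -/
theorem swap_mul_formPerm_append (a b : α) (l₁ l₂ : List α) (h : (a :: l₁ ++ b :: l₂).Nodup) :
    swap b a * (a :: l₁ ++ b :: l₂).formPerm = (a :: l₁).formPerm * (b :: l₂).formPerm := by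
  have h1 : (a :: l₁ ++ [b]).Nodup := by
    refine h.sublist ?_
    exact List.Sublist.append_left (by simp) _
  -- Rotating `b` to the front makes `swap b a` the first factor of this cycle, where the
  -- transposition on the left cancels it.
  have h2 : (a :: l₁ ++ [b]).formPerm = (b :: a :: l₁).formPerm := by
    refine (List.formPerm_eq_of_isRotated (List.nodup_append_comm.1 h1) ?_).symm
    exact ⟨1, by simp⟩
  rw [formPerm_append_cons, h2, List.formPerm_cons_cons, ← mul_assoc, ← mul_assoc, swap_mul_self,
    one_mul]

variable [Fintype α]

/-- The filter absorbs lists of length at most one, whose `formPerm` is the identity, so pieces of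
length one need no separate case later. -/
theorem cycleType_formPerm_eq_filter (l : List α) (h : l.Nodup) :
    l.formPerm.cycleType = Multiset.filter (2 ≤ ·) {l.length} := by
  rw [Multiset.filter_singleton]
  split_ifs with hl
  · rw [(List.isCycle_formPerm h hl).cycleType,
      List.support_formPerm_of_nodup l h (by rintro x rfl; simp at hl),
      List.toFinset_card_of_nodup h]
  · rw [Multiset.empty_eq_zero, cycleType_eq_zero, List.formPerm_eq_one_iff _ h]
    omega

theorem filter_two_le_parts_partition (w : Perm α) :
    Multiset.filter (2 ≤ ·) w.partition.parts = w.cycleType :=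
  filter_parts_partition_eq_cycleType

/-- All entries below 2 are ones, and the sum determines how many there are. This passes from
`cycleType`, which ignores fixed points, to full partitions. -/
theorem multiset_eq_of_filter_two_le {s t : Multiset ℕ} (hs : 0 ∉ s) (ht : 0 ∉ t)
    (h : s.filter (2 ≤ ·) = t.filter (2 ≤ ·)) (hsum : s.sum = t.sum) : s = t := by
  have key : ∀ u : Multiset ℕ, 0 ∉ u →
      u = u.filter (2 ≤ ·) + Multiset.replicate (u.sum - (u.filter (2 ≤ ·)).sum) 1 := by
    intro u hu
    have h1 : u.filter (fun x => ¬ 2 ≤ x) =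
        Multiset.replicate (Multiset.card (u.filter (fun x => ¬ 2 ≤ x))) 1 := by
      rw [Multiset.eq_replicate]
      refine ⟨rfl, fun b hb => ?_⟩
      rw [Multiset.mem_filter] at hb
      have : b ≠ 0 := fun h0 => hu (h0 ▸ hb.1)
      omega
    have h2 := Multiset.filter_add_not (2 ≤ ·) u
    have h3 := congrArg Multiset.sum h2
    rw [Multiset.sum_add, h1, Multiset.sum_replicate, smul_eq_mul, mul_one] at h3
    conv_lhs => rw [← h2, h1]
    rw [← h3, Nat.add_sub_cancel_left]
  rw [key s hs, key t ht, h, hsum]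

theorem zero_notMem_parts {n : ℕ} (p : n.Partition) : 0 ∉ p.parts :=
  fun h => (p.parts_pos h).false

/-- The effect on the cycle structure of cutting the cycle of `a` in two. -/
theorem parts_partition_swap_mul (w : Perm α) (a : α) {i : ℕ} (hi : 0 < i)
    (him : i < (w.cycleOf a).support.card) :
    (swap ((w ^ i) a) a * w).partition.parts + {(w.cycleOf a).support.card} =
      w.partition.parts + {i, (w.cycleOf a).support.card - i} := by
  set m := (w.cycleOf a).support.card with hm
  set l := w.toList a with hl
  have hlen : l.length = m := length_toList _ _
  have hnd : l.Nodup := nodup_toList w a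
  have ha : w a ≠ a := by
    intro h
    rw [← cycleOf_eq_one_iff] at h
    rw [hm, h] at him
    simp at him
  obtain ⟨l₁, hl₁⟩ : ∃ l₁, l.take i = a :: l₁ := by
    have : (l.take i) ≠ [] := by
      intro h
      have := congrArg List.length h
      simp at this
      rcases this with h | h
      · omega
      · rw [h] at hlen; simp at hlen; omega
    obtain ⟨x, xs, hx⟩ := List.exists_cons_of_ne_nil this
    refine ⟨xs, ?_⟩
    have h0 : (l.take i)[0]'(by rw [hx]; simp) = a := by
      rw [List.getElem_take]
      exact (getElem_toList w a 0 (by rw [← hl, hlen]; omega)).trans rfl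
    simp only [hx, List.getElem_cons_zero] at h0
    rw [hx, h0]
  obtain ⟨l₂, hl₂⟩ : ∃ l₂, l.drop i = (w ^ i) a :: l₂ := by
    refine ⟨l.drop (i + 1), ?_⟩
    rw [List.drop_eq_getElem_cons (by omega)]
    congr 1
    exact getElem_toList w a i (by rw [← hl, hlen]; omega)
  have hsplit : l = a :: l₁ ++ (w ^ i) a :: l₂ := by
    rw [← hl₁, ← hl₂, List.take_append_drop]
  have hlen₁ : (a :: l₁).length = i := by rw [← hl₁, List.length_take]; omega
  have hlen₂ : ((w ^ i) a :: l₂).length = m - i := by rw [← hl₂, List.length_drop]; omega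
  have hc : l.formPerm = w.cycleOf a := formPerm_toList w a
  set r := (w.cycleOf a)⁻¹ * w with hr
  have hw : w = w.cycleOf a * r := by rw [hr, mul_inv_cancel_left]
  -- The rest `r` of `w` is disjoint from the cycle of `a`, hence from both pieces of the cut list,
  -- and its cycles are unaffected.
  have hdis : Disjoint (w.cycleOf a) r := by
    have := (disjoint_mul_inv_of_mem_cycleFactorsFinset
      (cycleOf_mem_cycleFactorsFinset_iff.2 (mem_support.2 ha)))
    have hcm : w * (w.cycleOf a)⁻¹ = r := by
      rw [hr]
      have : Commute w (w.cycleOf a) := (self_mem_cycle_factors_commute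
        (cycleOf_mem_cycleFactorsFinset_iff.2 (mem_support.2 ha))).symm
      exact (this.inv_right).eq
    rw [hcm] at this
    exact this.symm
  have hsupp : ∀ x ∈ l, r x = x := by
    intro x hx
    rcases hdis x with h | h
    · rw [← hc] at h
      exact absurd ((List.formPerm_apply_mem_eq_self_iff _ hnd x hx).1 h) (by omega)
    · exact h
  have hd₁ : Disjoint (a :: l₁).formPerm r := by
    intro x
    by_cases hx : x ∈ a :: l₁
    · exact Or.inr (hsupp x (by rw [hsplit]; exact List.mem_append_left _ hx))
    · exact Or.inl (List.formPerm_apply_of_notMem hx)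
  have hd₂ : Disjoint ((w ^ i) a :: l₂).formPerm r := by
    intro x
    by_cases hx : x ∈ (w ^ i) a :: l₂
    · exact Or.inr (hsupp x (by rw [hsplit]; exact List.mem_append_right _ hx))
    · exact Or.inl (List.formPerm_apply_of_notMem hx)
  have hnd' := hnd
  rw [hsplit] at hnd'
  obtain ⟨hnd₁, hnd₂, hnd₃⟩ := List.nodup_append'.1 hnd'
  have hd₁₂ : Disjoint (a :: l₁).formPerm ((w ^ i) a :: l₂).formPerm := by
    intro x
    by_cases hx : x ∈ a :: l₁
    · exact Or.inr (List.formPerm_apply_of_notMem (hnd₃ hx))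
    · exact Or.inl (List.formPerm_apply_of_notMem hx)
  have hprod : swap ((w ^ i) a) a * w =
      (a :: l₁).formPerm * ((w ^ i) a :: l₂).formPerm * r := by
    rw [← swap_mul_formPerm_append _ _ _ _ hnd', ← hsplit, mul_assoc, hc, ← hw]
  have hct' : (swap ((w ^ i) a) a * w).cycleType =
      Multiset.filter (2 ≤ ·) {i} + Multiset.filter (2 ≤ ·) {m - i} + r.cycleType := by
    rw [hprod, (hd₁.mul_left hd₂).cycleType_mul, hd₁₂.cycleType_mul,
      cycleType_formPerm_eq_filter _ hnd₁, cycleType_formPerm_eq_filter _ hnd₂, hlen₁, hlen₂]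
  have hct : w.cycleType = Multiset.filter (2 ≤ ·) {m} + r.cycleType := by
    conv_lhs => rw [hw]
    rw [hdis.cycleType_mul, ← hc, cycleType_formPerm_eq_filter _ hnd, hlen]
  refine multiset_eq_of_filter_two_le ?_ ?_ ?_ ?_
  · rw [Multiset.mem_add, not_or]
    refine ⟨zero_notMem_parts _, ?_⟩
    simp; omega
  · rw [Multiset.mem_add, not_or]
    refine ⟨zero_notMem_parts _, ?_⟩
    simp; omega
  · rw [Multiset.filter_add, Multiset.filter_add, filter_two_le_parts_partition,
      filter_two_le_parts_partition, hct, hct', Multiset.insert_eq_cons, ← Multiset.singleton_add,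
      Multiset.filter_add]
    abel
  · rw [Multiset.sum_add, Multiset.sum_add, Nat.Partition.parts_sum, Nat.Partition.parts_sum]
    simp
    omega

theorem exists_pow_eq_of_sameCycle_of_ne {w : Perm α} {a b : α} (h : w.SameCycle a b)
    (hab : b ≠ a) : ∃ i, 0 < i ∧ i < (w.cycleOf a).support.card ∧ (w ^ i) a = b := by
  obtain ⟨i, hi, rfl⟩ := h.exists_pow_eq_of_mem_support
    (mem_support.2 fun h' => hab (h.eq_of_left h').symm)
  refine ⟨i, Nat.pos_of_ne_zero ?_, hi, rfl⟩
  rintro rfl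
  exact hab rfl

theorem card_parts_swap_mul_of_sameCycle {w : Perm α} {a b : α} (h : w.SameCycle a b)
    (hab : b ≠ a) : Multiset.card (swap b a * w).partition.parts =
      Multiset.card w.partition.parts + 1 := by
  obtain ⟨i, hi, him, rfl⟩ := exists_pow_eq_of_sameCycle_of_ne h hab
  have := congrArg Multiset.card (parts_partition_swap_mul w a hi him)
  simp at this ⊢
  omega

/-- Until the first return of `a` to itself under `w`, its orbit avoids both `a` and `b`, so the
transposition changes nothing. At the return time it sends `a` on to `b`. -/
theorem sameCycle_swap_mul {w : Perm α} {a b : α} (h : ¬ w.SameCycle a b) :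
    (swap b a * w).SameCycle a b := by
  have hex : ∃ m, 0 < m ∧ (w ^ m) a = a := ⟨orderOf w, orderOf_pos w, by simp [pow_orderOf_eq_one]⟩
  classical
  obtain ⟨hm, hma⟩ := Nat.find_spec hex
  have hmin : ∀ i, 0 < i → i < Nat.find hex → (w ^ i) a ≠ a :=
    fun i hi him hia => Nat.find_min hex him ⟨hi, hia⟩
  generalize Nat.find hex = m at hm hma hmin
  have key : ∀ i, i < m → ((swap b a * w) ^ i) a = (w ^ i) a := by
    intro i
    induction i with
    | zero => simp
    | succ i ih =>
      intro him
      rw [pow_succ', mul_apply, ih (by omega), mul_apply, ← mul_apply w, ← pow_succ']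
      refine swap_apply_of_ne_of_ne ?_ (hmin _ (by omega) him)
      intro hb
      exact h ⟨(i + 1 : ℕ), by rw [zpow_natCast]; exact hb⟩
  obtain ⟨i, rfl⟩ : ∃ i, m = i + 1 := ⟨m - 1, by omega⟩
  refine ⟨(i + 1 : ℕ), ?_⟩
  rw [zpow_natCast, pow_succ', mul_apply, key i (by omega), mul_apply, ← mul_apply w, ← pow_succ', hma,
    swap_apply_right]

/-- The transposition merges the two cycles, and applying it again is a cut that restores `w`. -/
theorem card_parts_swap_mul_of_not_sameCycle {w : Perm α} {a b : α} (h : ¬ w.SameCycle a b) :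
    Multiset.card (swap b a * w).partition.parts + 1 = Multiset.card w.partition.parts := by
  have hab : b ≠ a := by
    rintro rfl
    exact h (SameCycle.refl _ _)
  rw [← card_parts_swap_mul_of_sameCycle (sameCycle_swap_mul h) hab, swap_mul_self_mul]

theorem card_parts_swap_mul_le (w : Perm α) (a b : α) :
    Multiset.card (swap b a * w).partition.parts ≤ Multiset.card w.partition.parts + 1 := by
  by_cases hab : b = a
  · subst hab
    rw [swap_self]
    exact Nat.le_succ _
  by_cases h : w.SameCycle a b
  · exact (card_parts_swap_mul_of_sameCycle h hab).le
  · have := card_parts_swap_mul_of_not_sameCycle h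
    omega

open scoped Classical in
/-- The cycle lengths of `w`, fixed points included, are the sizes of the orbits. -/
theorem parts_partition_eq_map_quotient (w : Perm α) :
    w.partition.parts = (Finset.univ : Finset (Quotient (SameCycle.setoid w))).val.map
      fun q => Set.ncard {x : α | (Quotient.mk (SameCycle.setoid w) x) = q} := by
  have hmk : ∀ x y : α, (Quotient.mk (SameCycle.setoid w) x) = Quotient.mk _ y ↔ w.SameCycle x y :=
    fun x y => Quotient.eq
  have hout : ∀ q : Quotient (SameCycle.setoid w), Quotient.mk _ q.out = q := Quotient.out_eq
  have hfil : ∀ q : Quotient (SameCycle.setoid w),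
      2 ≤ Set.ncard {x : α | (Quotient.mk (SameCycle.setoid w) x) = q} → q.out ∈ w.support := by
    intro q hq
    rw [mem_support]
    intro hfix
    have hsub : ({x : α | (Quotient.mk (SameCycle.setoid w) x) = q} : Set α) ⊆ {q.out} := by
      intro x hx
      rw [Set.mem_ofPred_eq, ← hout q, hmk] at hx
      exact hx.eq_of_right hfix
    have := Set.ncard_le_ncard hsub
    rw [Set.ncard_singleton] at this
    omega
  have hcard : ∀ q : Quotient (SameCycle.setoid w), q.out ∈ w.support →
      Set.ncard {x : α | (Quotient.mk (SameCycle.setoid w) x) = q} =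
        (w.cycleOf q.out).support.card := by
    intro q hq
    rw [← Set.ncard_coe_finset]
    congr 1
    ext x
    rw [Set.mem_ofPred_eq, Finset.mem_coe, mem_support_cycleOf_iff' (mem_support.1 hq), ← hmk, hout,
      eq_comm]
  refine multiset_eq_of_filter_two_le (zero_notMem_parts _) ?_ ?_ ?_
  · intro h
    obtain ⟨q, -, hq⟩ := Multiset.mem_map.1 h
    rw [Set.ncard_eq_zero] at hq
    have : q.out ∈ ({x : α | (Quotient.mk (SameCycle.setoid w) x) = q} : Set α) := hout q
    rw [hq] at this
    exact this
  · rw [filter_two_le_parts_partition, Multiset.filter_map, cycleType_def]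
    symm
    refine Multiset.map_eq_map_of_bij_of_nodup _ _ ((Finset.nodup _).filter _) (Finset.nodup _)
      (fun q _ => w.cycleOf q.out) ?_ ?_ ?_ ?_
    · intro q hq
      rw [Finset.mem_val, cycleOf_mem_cycleFactorsFinset_iff]
      exact hfil q (Multiset.mem_filter.1 hq).2
    · intro q hq q' hq' h
      have := (sameCycle_iff_cycleOf_eq_of_mem_support (hfil q (Multiset.mem_filter.1 hq).2)
        (hfil q' (Multiset.mem_filter.1 hq').2)).2 h
      rw [← hout q, ← hout q', hmk]
      exact this
    · intro c hc
      obtain ⟨x, hx⟩ := (mem_cycleFactorsFinset_iff.1 hc).1.nonempty_support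
      have hcx := cycle_is_cycleOf hx hc
      have hxw : x ∈ w.support := mem_cycleFactorsFinset_support_le hc hx
      have hsc : w.SameCycle (Quotient.mk (SameCycle.setoid w) x).out x :=
        (hmk _ _).1 (hout _)
      have hout' := hsc.symm.mem_support_iff.1 hxw
      refine ⟨Quotient.mk _ x, ?_, (hcx.trans hsc.symm.cycleOf_eq).symm⟩
      rw [Multiset.mem_filter]
      refine ⟨Finset.mem_univ _, ?_⟩
      rw [Function.comp_apply, hcard _ hout', ← hsc.symm.cycleOf_eq, ← hcx]
      exact (mem_cycleFactorsFinset_iff.1 hc).1.two_le_card_support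
    · intro q hq
      exact hcard q (hfil q (Multiset.mem_filter.1 hq).2)
  · rw [Nat.Partition.parts_sum]
    have h' := Finset.card_eq_sum_card_fiberwise (s := (Finset.univ : Finset α))
      (t := (Finset.univ : Finset (Quotient (SameCycle.setoid w))))
      (f := fun x => Quotient.mk (SameCycle.setoid w) x) (by simp)
    rw [Finset.card_univ] at h'
    rw [h']
    refine Finset.sum_congr rfl fun q _ => ?_
    rw [Set.ncard_eq_toFinset_card']
    congr 1
    ext x
    simp

end CycleStructure

/-! ### Matchings, the coset graph and the copy of $S_n$ on the unbarred points -/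

section CosetType

variable {n : ℕ}

open Equiv Equiv.Perm

theorem bar_bar (x : Pt n) : bar (bar x) = x := by
  simp [bar]

theorem bar_ne (x : Pt n) : bar x ≠ x := by
  intro h
  have := congrArg Prod.snd h
  simp [bar] at this

/-- The bar involution as a permutation. -/
def barPerm (n : ℕ) : Sym2n n where
  toFun := bar
  invFun := bar
  left_inv := bar_bar
  right_inv := bar_bar

@[simp] theorem barPerm_apply (x : Pt n) : barPerm n x = bar x := rfl

theorem barPerm_mul_self : barPerm n * barPerm n = 1 :=
  Equiv.ext bar_bar

theorem barPerm_inv : (barPerm n)⁻¹ = barPerm n :=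
  inv_eq_of_mul_eq_one_left barPerm_mul_self

theorem mem_hyperoctahedral_iff (σ : Sym2n n) :
    σ ∈ hyperoctahedral n ↔ ∀ x, σ (bar x) = bar (σ x) := Iff.rfl

theorem mem_hyperoctahedral_iff_mul (σ : Sym2n n) :
    σ ∈ hyperoctahedral n ↔ σ * barPerm n = barPerm n * σ :=
  ⟨fun h => Equiv.ext h, fun h x => DFunLike.congr_fun h x⟩

/-- The matching `{σ(i), σ(ī)}`, as a fixed-point free involution. -/
def matching (σ : Sym2n n) : Sym2n n := σ * barPerm n * σ⁻¹

theorem matching_mul_left (σ τ : Sym2n n) : matching (τ * σ) = τ * matching σ * τ⁻¹ := by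
  simp only [matching, mul_inv_rev, mul_assoc]

theorem matching_mul_self (σ : Sym2n n) : matching σ * matching σ = 1 := by
  have := barPerm_mul_self (n := n)
  simp [matching, mul_assoc, ← mul_assoc (barPerm n) (barPerm n), this]

theorem matching_matching_apply (σ : Sym2n n) (x : Pt n) : matching σ (matching σ x) = x :=
  DFunLike.congr_fun (matching_mul_self σ) x

theorem matching_apply_ne (σ : Sym2n n) (x : Pt n) : matching σ x ≠ x := by
  intro h
  rw [matching, mul_apply, mul_apply] at h
  exact bar_ne (σ⁻¹ x) (by rw [eq_inv_iff_eq]; exact h)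

/-- $H_n$ is the centralizer of `barPerm n`, so conjugates of `barPerm n` correspond to left cosets
of $H_n$. -/
theorem matching_eq_iff (σ τ : Sym2n n) :
    matching σ = matching τ ↔ σ⁻¹ * τ ∈ hyperoctahedral n := by
  rw [mem_hyperoctahedral_iff_mul, matching, matching]
  constructor
  · intro h
    have := congrArg (fun x => σ⁻¹ * x * τ) h
    simp only [mul_assoc, inv_mul_cancel_left, inv_mul_cancel, mul_one] at this
    rw [this, mul_assoc]
  · intro h
    have := congrArg (fun x => σ * x * τ⁻¹) h
    simp only [mul_assoc, mul_inv_cancel_left, mul_inv_cancel, mul_one] at this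
    rw [mul_assoc, mul_assoc, this]

theorem matching_mul_right (σ : Sym2n n) {h : Sym2n n} (hh : h ∈ hyperoctahedral n) :
    matching (σ * h) = matching σ :=
  ((matching_eq_iff _ _).2 (by simpa using hh)).symm

/-- The product of the two matchings of the graph `G_σ`. -/
def matchingProd (σ : Sym2n n) : Sym2n n := barPerm n * matching σ

theorem matchingProd_apply (σ : Sym2n n) (x : Pt n) :
    matchingProd σ x = bar (matching σ x) := rfl

/-- Both matchings are fixed-point free involutions, so the symmetrization and the removal of loops
in `SimpleGraph.fromRel` change nothing. -/
theorem cosetGraph_adj (σ : Sym2n n) (x y : Pt n) :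
    (cosetGraph σ).Adj x y ↔ y = bar x ∨ y = matching σ x := by
  have hm : ∀ x y : Pt n, (∃ z, x = σ z ∧ y = σ (bar z)) ↔ y = matching σ x := by
    intro x y
    constructor
    · rintro ⟨z, rfl, rfl⟩
      simp [matching]
    · rintro rfl
      exact ⟨σ⁻¹ x, by simp, by simp [matching]⟩
  rw [cosetGraph, SimpleGraph.fromRel_adj, hm, hm]
  constructor
  · rintro ⟨-, (h | h) | (h | h)⟩
    · exact Or.inl h
    · exact Or.inr h
    · exact Or.inl (by rw [h, bar_bar])
    · exact Or.inr (by rw [h, matching_matching_apply])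
  · rintro (h | h)
    · exact ⟨fun hxy => bar_ne x (by rw [← h, ← hxy]), Or.inl (Or.inl h)⟩
    · exact ⟨fun hxy => matching_apply_ne σ x (by rw [← h, ← hxy]), Or.inl (Or.inr h)⟩

theorem cosetType_eq_of_iso {σ τ : Sym2n n} (e : cosetGraph σ ≃g cosetGraph τ) :
    cosetType σ = cosetType τ := by
  classical
  refine Nat.Partition.ext ?_
  refine Multiset.map_eq_map_of_bij_of_nodup _ _ (Finset.nodup _) (Finset.nodup _)
    (fun c _ => e.connectedComponentEquiv c) (fun _ _ => Finset.mem_univ _)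
    (fun _ _ _ _ h => e.connectedComponentEquiv.injective h)
    (fun c _ => ⟨e.connectedComponentEquiv.symm c, Finset.mem_univ _, by simp⟩) ?_
  intro c _
  congr 1
  exact Nat.card_congr (c.isoEquivSupp e)

theorem cosetType_mul_left (σ : Sym2n n) {h : Sym2n n} (hh : h ∈ hyperoctahedral n) :
    cosetType (h * σ) = cosetType σ := by
  refine (cosetType_eq_of_iso ⟨h, ?_⟩).symm
  intro x y
  rw [cosetGraph_adj, cosetGraph_adj, matching_mul_left]
  simp [← (mem_hyperoctahedral_iff h).1 hh x]

theorem cosetType_mul_right (σ : Sym2n n) {h : Sym2n n} (hh : h ∈ hyperoctahedral n) :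
    cosetType (σ * h) = cosetType σ := by
  refine (cosetType_eq_of_iso ⟨1, ?_⟩).symm
  intro x y
  rw [cosetGraph_adj, cosetGraph_adj, matching_mul_right σ hh]
  simp

/-- The points `i` (for `c = false`) or the points `ī` (for `c = true`). -/
def levelEquiv (n : ℕ) (c : Bool) : Fin n ≃ {x : Pt n // x.2 = c} where
  toFun i := ⟨(i, c), rfl⟩
  invFun x := x.1.1
  left_inv _ := rfl
  right_inv x := Subtype.ext (Prod.ext rfl x.2.symm)

/-- The permutation acting as `w` on one of the two levels and trivially on the other. -/
def levelPerm (c : Bool) (w : Perm (Fin n)) : Sym2n n := w.extendDomain (levelEquiv n c)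

theorem levelPerm_apply (c : Bool) (w : Perm (Fin n)) (x : Pt n) :
    levelPerm c w x = (if x.2 = c then w x.1 else x.1, x.2) := by
  rcases x with ⟨i, b⟩
  by_cases h : b = c
  · subst h
    rw [if_pos rfl]
    exact extendDomain_apply_image w (levelEquiv n b) i
  · simp only [h, if_false]
    exact extendDomain_apply_not_subtype w (levelEquiv n c) h

theorem levelPerm_mul (c : Bool) (u v : Perm (Fin n)) :
    levelPerm c (u * v) = levelPerm c u * levelPerm c v :=
  (extendDomain_mul _ _ _).symm

theorem levelPerm_inv (c : Bool) (w : Perm (Fin n)) : levelPerm c w⁻¹ = (levelPerm c w)⁻¹ :=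
  (extendDomain_inv _ _).symm

theorem barPerm_conj_levelPerm (c : Bool) (w : Perm (Fin n)) :
    barPerm n * levelPerm c w * barPerm n = levelPerm (!c) w := by
  ext1 ⟨i, b⟩
  cases b <;> cases c <;> simp [levelPerm_apply, bar]

theorem levelPerm_mul_levelPerm_mem (c : Bool) (w : Perm (Fin n)) :
    levelPerm c w * levelPerm (!c) w ∈ hyperoctahedral n := by
  rintro ⟨i, b⟩
  cases b <;> cases c <;> simp [levelPerm_apply, bar]

theorem swap_mul_levelPerm (c : Bool) (a b : Fin n) (w : Perm (Fin n)) :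
    swap (b, c) (a, c) * levelPerm c w = levelPerm c (swap b a * w) := by
  rw [levelPerm_mul]
  congr 1
  ext1 ⟨i, d⟩
  rw [levelPerm_apply, swap_apply_def, swap_apply_def]
  simp only [Prod.mk.injEq]
  by_cases hd : d = c
  · subst hd
    simp only [and_true, if_true]
    split_ifs <;> rfl
  · simp [hd]

theorem matching_levelPerm_false (w : Perm (Fin n)) (i : Fin n) :
    matching (levelPerm false w) (i, true) = (w i, false) := by
  simp [matching, ← levelPerm_inv, levelPerm_apply, bar]

theorem matching_levelPerm_false' (w : Perm (Fin n)) (i : Fin n) :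
    matching (levelPerm false w) (w i, false) = (i, true) := by
  rw [← matching_levelPerm_false, matching_matching_apply]

/-- Bar edges identify the two levels, and each remaining edge joins `(i, true)` to `(w i, false)`;
modulo levels, walks are therefore moves along cycles of `w`. -/
theorem cosetGraph_reachable_levelPerm (w : Perm (Fin n)) (x y : Pt n) :
    (cosetGraph (levelPerm false w)).Reachable x y ↔ w.SameCycle x.1 y.1 := by
  have hb : ∀ x, (cosetGraph (levelPerm false w)).Reachable x (bar x) := fun x =>
    ((cosetGraph_adj _ _ _).2 (Or.inl rfl)).reachable
  have hlevel : ∀ (i : Fin n) (b c : Bool),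
      (cosetGraph (levelPerm false w)).Reachable (i, b) (i, c) := by
    intro i b c
    cases b <;> cases c
    · rfl
    · exact hb _
    · exact hb _
    · rfl
  constructor
  · rintro ⟨p⟩
    induction p with
    | nil => exact SameCycle.refl _ _
    | @cons u v _ h _ ih =>
      refine SameCycle.trans ?_ ih
      rcases (cosetGraph_adj _ _ _).1 h with rfl | rfl
      · exact SameCycle.refl _ _
      · rcases u with ⟨i, b⟩
        cases b
        · obtain ⟨k, rfl⟩ := w.surjective i
          rw [matching_levelPerm_false', sameCycle_apply_left]
        · rw [matching_levelPerm_false, sameCycle_apply_right]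
  · intro h
    obtain ⟨k, hk⟩ := h.exists_nat_pow_eq
    rcases x with ⟨i, b⟩
    rcases y with ⟨j, c⟩
    dsimp only at hk
    subst hk
    refine SimpleGraph.Reachable.trans ?_ (hlevel _ true c)
    clear h
    induction k with
    | zero => exact hlevel _ _ _
    | succ k ih =>
      refine ih.trans (SimpleGraph.Reachable.trans ?_ (hlevel _ false true))
      rw [pow_succ', mul_apply]
      exact ((cosetGraph_adj _ _ _).2 (Or.inr (matching_levelPerm_false _ _).symm)).reachable

theorem parts_cosetType_levelPerm (w : Perm (Fin n)) :
    (cosetType (levelPerm false w)).parts = w.partition.parts := by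
  classical
  rw [parts_partition_eq_map_quotient]
  have hmk : ∀ x y : Fin n, (Quotient.mk (SameCycle.setoid w) x) = Quotient.mk _ y ↔
    w.SameCycle x y := fun x y => Quotient.eq
  have hC : ∀ x y : Pt n, (cosetGraph (levelPerm false w)).connectedComponentMk x =
      (cosetGraph (levelPerm false w)).connectedComponentMk y ↔ w.SameCycle x.1 y.1 := fun x y => by
    rw [SimpleGraph.ConnectedComponent.eq, cosetGraph_reachable_levelPerm]
  choose r hr using fun c : (cosetGraph (levelPerm false w)).ConnectedComponent => c.exists_rep
  replace hr : ∀ c, (cosetGraph (levelPerm false w)).connectedComponentMk (r c) = c := hr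
  refine Multiset.map_eq_map_of_bij_of_nodup _ _ (Finset.nodup _) (Finset.nodup _)
    (fun c _ => Quotient.mk _ (r c).1) (fun c _ => Finset.mem_univ_val _) ?_ ?_ ?_
  · intro c _ d _ h
    rw [← hr c, ← hr d, hC, ← hmk]
    exact h
  · intro q _
    obtain ⟨i, rfl⟩ := Quotient.exists_rep q
    refine ⟨(cosetGraph (levelPerm false w)).connectedComponentMk (i, false),
      Finset.mem_univ_val _, ?_⟩
    exact (hmk _ _).2 ((hC _ (i, false)).1 (hr _))
  · intro c _
    rw [ncard_supp, Nat.mul_div_cancel_left _ two_pos]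
    congr 1
    ext i
    rw [Set.mem_ofPred_eq, Set.mem_ofPred_eq, SimpleGraph.ConnectedComponent.mem_supp_iff, hmk]
    conv_lhs => rw [← hr c, hC]

theorem cycleType_levelPerm (c : Bool) (w : Perm (Fin n)) :
    (levelPerm c w).cycleType = w.cycleType :=
  cycleType_extendDomain _

theorem matchingProd_levelPerm (w : Perm (Fin n)) :
    matchingProd (levelPerm false w) = levelPerm true w * levelPerm false w⁻¹ := by
  rw [matchingProd, matching, levelPerm_inv]
  have := barPerm_conj_levelPerm false w
  rw [Bool.not_false] at this
  rw [← this]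
  simp only [mul_assoc]

/-- The product acts as `w` on the barred level and as `w⁻¹` on the other, so every cycle of `w` is
counted twice. -/
theorem card_parts_matchingProd_levelPerm (w : Perm (Fin n)) :
    Multiset.card (matchingProd (levelPerm false w)).partition.parts =
      2 * Multiset.card w.partition.parts := by
  have hd : Disjoint (levelPerm true w) (levelPerm false w⁻¹) := by
    rintro ⟨i, b⟩
    cases b <;> simp [levelPerm_apply]
  rw [parts_partition, parts_partition, ← sum_cycleType, ← sum_cycleType, matchingProd_levelPerm,
    hd.cycleType_mul, cycleType_levelPerm, cycleType_levelPerm, cycleType_inv]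
  have := w.sum_cycleType_le
  simp at this ⊢
  omega

end CosetType

/-! ### Double cosets of $H_n$, and transpositions acting on coset-types -/

section DoubleCosets

variable {n : ℕ}

open Equiv Equiv.Perm

/-- This is the dihedral relation: conjugation by one of two involutions inverts their product. -/
theorem barPerm_mul_matchingProd_zpow (σ : Sym2n n) (k : ℤ) (x : Pt n) :
    bar ((matchingProd σ ^ k) x) = (matchingProd σ ^ (-k)) (bar x) := by
  have h1 : barPerm n * matchingProd σ * (barPerm n)⁻¹ = (matchingProd σ)⁻¹ := by
    rw [barPerm_inv, matchingProd, ← mul_assoc, barPerm_mul_self, one_mul, mul_inv_rev, barPerm_inv,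
      inv_eq_of_mul_eq_one_left (matching_mul_self σ)]
  have h2 : barPerm n * matchingProd σ ^ k = matchingProd σ ^ (-k) * barPerm n := by
    rw [zpow_neg, ← inv_zpow, ← h1, conj_zpow, inv_mul_cancel_right]
  exact DFunLike.congr_fun h2 x

/-- If the $k$-th power sent $x$ to $\bar x$, the dihedral relation applied halfway along the orbit
would give a fixed point of the bar for even $k$, and of the other matching for odd $k$. -/
theorem not_sameCycle_bar (σ : Sym2n n) (x : Pt n) : ¬ (matchingProd σ).SameCycle x (bar x) := by
  rintro ⟨k, hk⟩
  have key : ∀ l m : ℤ, k = l + m → (matchingProd σ ^ m) x = bar ((matchingProd σ ^ l) x) := by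
    intro l m hlm
    rw [barPerm_mul_matchingProd_zpow, ← hk, hlm, ← mul_apply, ← zpow_add, neg_add_cancel_left]
  rcases Int.even_or_odd' k with ⟨l, hl | hl⟩
  · exact bar_ne _ (key l l (by omega)).symm
  · have h := key l (1 + l) (by omega)
    rw [zpow_add, zpow_one, mul_apply, matchingProd_apply] at h
    have h' := congrArg bar h
    rw [bar_bar, bar_bar] at h'
    exact matching_apply_ne _ _ h'

theorem sameCycle_bar_bar (σ : Sym2n n) {x y : Pt n} :
    (matchingProd σ).SameCycle (bar x) (bar y) ↔ (matchingProd σ).SameCycle x y := by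
  have key : ∀ x y : Pt n, (matchingProd σ).SameCycle x y →
      (matchingProd σ).SameCycle (bar x) (bar y) := by
    rintro x y ⟨k, rfl⟩
    exact ⟨-k, (barPerm_mul_matchingProd_zpow σ k x).symm⟩
  exact ⟨fun h => by simpa only [bar_bar] using key _ _ h, key _ _⟩

/-- The graph of `σ` has a proper colouring with two colours. -/
theorem exists_coloring (σ : Sym2n n) (x₀ : Pt n) : ∃ c : Pt n → Bool,
    (∀ x, c (bar x) = !c x) ∧ (∀ x, c (matching σ x) = !c x) ∧ c x₀ = false := by
  classical
  suffices h : ∃ c : Pt n → Bool, (∀ x, c (bar x) = !c x) ∧ (∀ x, c (matching σ x) = !c x) by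
    obtain ⟨c, h1, h2⟩ := h
    exact ⟨fun x => xor (c x) (c x₀), fun x => by simp [h1], fun x => by simp [h2], by simp⟩
  let Q := Quotient (SameCycle.setoid (matchingProd σ))
  let e := Fintype.equivFin Q
  let q : Pt n → Q := fun x => Quotient.mk _ x
  have hq : ∀ x y, q x = q y ↔ (matchingProd σ).SameCycle x y := fun x y => Quotient.eq
  have h0 : ∀ x, e (q x) ≠ e (q (bar x)) := fun x h =>
    not_sameCycle_bar σ x ((hq _ _).1 (e.injective h))
  have h1 : ∀ x, q (matching σ x) = q (bar x) := by
    intro x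
    rw [hq, ← sameCycle_bar_bar, bar_bar, ← matchingProd_apply, sameCycle_apply_left]
  have h2 : ∀ x, q (bar (matching σ x)) = q x := by
    intro x
    rw [hq, ← matchingProd_apply, sameCycle_apply_left]
  -- The orbits of `x` and `bar x` are distinct, and each matching sends a point of one to a point
  -- of the other. The colour tells which of the two comes first in an arbitrary order.
  refine ⟨fun x => decide (e (q x) < e (q (bar x))), fun x => ?_, fun x => ?_⟩
  · rcases lt_or_gt_of_ne (h0 x) with h | h <;> simp [bar_bar, h, h.le]
  · rcases lt_or_gt_of_ne (h0 x) with h | h <;> simp [h1, h2, h, h.le]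

/-- Every double coset of the hyperoctahedral group meets `S_n`. -/
theorem exists_eq_levelPerm (σ : Sym2n n) (a : Fin n) :
    ∃ h ∈ hyperoctahedral n, ∃ h' ∈ hyperoctahedral n, ∃ w : Perm (Fin n),
      h (a, false) = (a, false) ∧ h * σ * h' = levelPerm false w := by
  obtain ⟨c, hb, hm, h0⟩ := exists_coloring σ (a, false)
  have hc : ∀ i b, c (i, b) = xor b (c (i, false)) := by
    intro i b
    cases b
    · simp
    · simpa [bar] using hb (i, false)
  have hinv : ∀ x : Pt n, (((x.1, c x) : Pt n).1, c (x.1, c x)) = x := by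
    rintro ⟨i, b⟩
    refine Prod.ext rfl ?_
    dsimp only
    rw [hc i (c (i, b)), hc i b]
    simp
  -- `h` moves every point to the level named by its colour, so the transported matching joins
  -- opposite levels. The normalization of `c` at `(a, false)` makes `h` fix that point.
  let h : Sym2n n := ⟨fun x => (x.1, c x), fun x => (x.1, c x), hinv, hinv⟩
  have happ : ∀ x, h x = (x.1, c x) := fun _ => rfl
  have hH : h ∈ hyperoctahedral n := by
    intro x
    rw [happ, happ, hb]
    rfl
  have hlev : ∀ x, (matching (h * σ) x).2 = !x.2 := by
    intro x
    obtain ⟨y, rfl⟩ := h.surjective x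
    rw [matching_mul_left, mul_apply, mul_apply, Perm.inv_def, symm_apply_apply, happ, happ, hm]
  have hinj : Function.Injective fun i => (matching (h * σ) (i, true)).1 := by
    intro i j hij
    have : matching (h * σ) (i, true) = matching (h * σ) (j, true) :=
      Prod.ext hij (by rw [hlev, hlev])
    exact congrArg Prod.fst ((matching (h * σ)).injective this)
  let w : Perm (Fin n) := Equiv.ofBijective _ (Finite.injective_iff_bijective.1 hinj)
  have hw : ∀ i, matching (h * σ) (i, true) = (w i, false) := fun i => Prod.ext rfl (hlev _)
  have hmat : matching (h * σ) = matching (levelPerm false w) := by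
    ext1 ⟨i, b⟩
    cases b
    · obtain ⟨k, rfl⟩ := w.surjective i
      rw [matching_levelPerm_false', ← hw, matching_matching_apply]
    · rw [matching_levelPerm_false, hw]
  refine ⟨h, hH, (h * σ)⁻¹ * levelPerm false w, (matching_eq_iff _ _).1 hmat, w, ?_, ?_⟩
  · rw [happ, h0]
  · rw [mul_inv_cancel_left]

theorem exists_eq_levelPerm' (σ : Sym2n n) :
    ∃ h ∈ hyperoctahedral n, ∃ h' ∈ hyperoctahedral n, ∃ w : Perm (Fin n),
      h * σ * h' = levelPerm false w := by
  rcases n with _ | n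
  · exact ⟨1, one_mem _, 1, one_mem _, 1, Subsingleton.elim _ _⟩
  · obtain ⟨h, hh, h', hh', w, -, hw⟩ := exists_eq_levelPerm σ 0
    exact ⟨h, hh, h', hh', w, hw⟩

theorem cosetType_mul_mul (σ : Sym2n n) {h h' : Sym2n n} (hh : h ∈ hyperoctahedral n)
    (hh' : h' ∈ hyperoctahedral n) : cosetType (h * σ * h') = cosetType σ := by
  rw [cosetType_mul_right _ hh', cosetType_mul_left _ hh]

/-- Permutations of the same coset-type lie in the same double coset. -/
theorem exists_eq_mul_mul_of_cosetType_eq {σ τ : Sym2n n} (hst : cosetType σ = cosetType τ) :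
    ∃ h ∈ hyperoctahedral n, ∃ h' ∈ hyperoctahedral n, τ = h * σ * h' := by
  obtain ⟨h₁, hh₁, h₁', hh₁', u, hu⟩ := exists_eq_levelPerm' σ
  obtain ⟨h₂, hh₂, h₂', hh₂', v, hv⟩ := exists_eq_levelPerm' τ
  have huv : u.cycleType = v.cycleType := by
    rw [← filter_two_le_parts_partition, ← filter_two_le_parts_partition,
      ← parts_cosetType_levelPerm, ← parts_cosetType_levelPerm, ← hu, ← hv,
      cosetType_mul_mul _ hh₁ hh₁', cosetType_mul_mul _ hh₂ hh₂', hst]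
  obtain ⟨g, hg⟩ := isConj_iff.1 (isConj_of_cycleType_eq huv)
  have hgm := levelPerm_mul_levelPerm_mem false g
  set d := levelPerm false g * levelPerm (!false) g with hd
  have hvd : levelPerm false v = d * levelPerm false u * d⁻¹ := by
    rw [eq_mul_inv_iff_mul_eq, ← hg, hd]
    ext1 ⟨i, b⟩
    cases b <;> simp [levelPerm_apply]
  refine ⟨h₂⁻¹ * (d * h₁), mul_mem (inv_mem hh₂) (mul_mem hgm hh₁),
    h₁' * d⁻¹ * h₂'⁻¹, mul_mem (mul_mem hh₁' (inv_mem hgm)) (inv_mem hh₂'), ?_⟩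
  have : τ = h₂⁻¹ * (levelPerm false v) * h₂'⁻¹ := by
    rw [← hv]
    simp [mul_assoc]
  rw [this, hvd, ← hu]
  simp only [mul_assoc]

theorem exists_cosetType_eq (μ : n.Partition) : ∃ σ : Sym2n n, cosetType σ = μ := by
  have h : ∃ w : Perm (Fin n), w.cycleType = μ.parts.filter (2 ≤ ·) := by
    rw [exists_with_cycleType_iff]
    refine ⟨?_, fun a ha => (Multiset.mem_filter.1 ha).2⟩
    have := congrArg Multiset.sum (Multiset.filter_add_not (2 ≤ ·) μ.parts)
    rw [Multiset.sum_add, μ.parts_sum] at this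
    rw [Fintype.card_fin]
    omega
  obtain ⟨w, hw⟩ := h
  refine ⟨levelPerm false w, Nat.Partition.ext ?_⟩
  rw [parts_cosetType_levelPerm]
  refine multiset_eq_of_filter_two_le (zero_notMem_parts _) (zero_notMem_parts _) ?_ ?_
  · rw [filter_two_le_parts_partition, hw]
  · rw [μ.parts_sum, Nat.Partition.parts_sum, Fintype.card_fin]

theorem card_parts_partition_conj {α : Type*} [Fintype α] [DecidableEq α] (g w : Perm α) :
    Multiset.card (g * w * g⁻¹).partition.parts = Multiset.card w.partition.parts := by
  rw [partition_eq_of_isConj.1 (isConj_iff.2 ⟨g, rfl⟩ : IsConj w (g * w * g⁻¹))]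

/-- Both sides are constant on double cosets, which reduces the claim to $S_n$. It turns questions
on coset-types into counts of cycles. -/
theorem card_parts_matchingProd (σ : Sym2n n) :
    Multiset.card (matchingProd σ).partition.parts = 2 * Multiset.card (cosetType σ).parts := by
  obtain ⟨h, hh, h', hh', w, hw⟩ := exists_eq_levelPerm' σ
  rw [← cosetType_mul_mul σ hh hh', hw, parts_cosetType_levelPerm,
    ← card_parts_matchingProd_levelPerm, ← hw]
  have : matchingProd (h * σ * h') = h * matchingProd σ * h⁻¹ := by
    rw [matchingProd, matching_mul_right _ hh', matching_mul_left, matchingProd, ← mul_assoc,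
      ← mul_assoc, ← mul_assoc, (mem_hyperoctahedral_iff_mul h).1 hh]
  rw [this, card_parts_partition_conj]

/-- Up to conjugation, one transposition applied to `σ` amounts to two applied to the product of
matchings: itself and its bar image. -/
theorem matchingProd_swap_mul (σ : Sym2n n) (x y : Pt n) :
    swap y x * matchingProd (swap y x * σ) * (swap y x)⁻¹ =
      swap y x * (swap (bar y) (bar x) * matchingProd σ) := by
  have : swap (bar y) (bar x) = barPerm n * swap y x * (barPerm n)⁻¹ := by
    rw [mul_swap_eq_swap_mul, mul_inv_cancel_right]
    rfl
  rw [this, matchingProd, matchingProd, matching_mul_left, barPerm_inv]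
  simp only [swap_inv, mul_assoc, swap_mul_self, mul_one, ← mul_assoc (barPerm n) (barPerm n),
    barPerm_mul_self, one_mul]

/-- Multiplication by `(y x)` increases the number of parts of the coset-type only if `x` and `y`
lie in the same cycle and have the same colour. -/
theorem card_parts_cosetType_swap_mul_le_of_not_sameCycle (σ : Sym2n n) {x y : Pt n}
    (h : ¬ (matchingProd σ).SameCycle x y) :
    Multiset.card (cosetType (swap y x * σ)).parts ≤ Multiset.card (cosetType σ).parts := by
  have h1 := card_parts_swap_mul_le (swap (bar y) (bar x) * matchingProd σ) x y
  -- The first of the two transpositions merges cycles and the second adds at most one, so twice the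
  -- number of parts does not grow.
  have h2 := card_parts_swap_mul_of_not_sameCycle (mt (sameCycle_bar_bar σ).1 h)
  rw [← matchingProd_swap_mul, card_parts_partition_conj, card_parts_matchingProd] at h1
  rw [card_parts_matchingProd] at h2
  omega

theorem card_parts_cosetType_swap_mul_le (σ : Sym2n n) (x y : Pt n) :
    Multiset.card (cosetType (swap y x * σ)).parts ≤ Multiset.card (cosetType σ).parts + 1 := by
  have h1 := card_parts_swap_mul_le (swap (bar y) (bar x) * matchingProd σ) x y
  have h2 := card_parts_swap_mul_le (matchingProd σ) (bar x) (bar y)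
  rw [← matchingProd_swap_mul, card_parts_partition_conj, card_parts_matchingProd] at h1
  rw [card_parts_matchingProd] at h2
  omega

end DoubleCosets

/-! ### Complete and elementary symmetric functions in a ring -/

section SymmetricFunctions

variable {R : Type*} [Ring R] {n : ℕ}

open scoped Classical in
/-- The complete homogeneous symmetric function of degree `k` in the first `m` of the `x_i`. -/
noncomputable def completeUpTo (x : Fin n → R) (m k : ℕ) : R :=
  ∑ f : Fin k → Fin n with Monotone f ∧ ∀ t, ((f t : Fin n) : ℕ) < m,
    (List.ofFn fun t => x (f t)).prod

theorem complete_eq_completeUpTo (x : Fin n → R) (k : ℕ) : complete k x = completeUpTo x n k := by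
  simp [complete, completeUpTo]

theorem completeUpTo_zero_right (x : Fin n → R) (m : ℕ) : completeUpTo x m 0 = 1 := by
  simp [completeUpTo, Subsingleton.monotone]

theorem completeUpTo_zero_succ (x : Fin n → R) (k : ℕ) : completeUpTo x 0 (k + 1) = 0 := by
  simp [completeUpTo]

/-- The last index of a monotone sequence is the largest; the two terms correspond to its being
different from `i` or equal to `i`. Indices start at 0, so `x i` is the last of the first `i + 1`
variables. -/
theorem completeUpTo_succ_succ (x : Fin n → R) (i : Fin n) (k : ℕ) :
    completeUpTo x (i + 1) (k + 1) =
      completeUpTo x i (k + 1) + completeUpTo x (i + 1) k * x i := by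
  classical
  rw [completeUpTo, ← Finset.sum_filter_add_sum_filter_not _ (fun f => f (Fin.last k) ≠ i)]
  congr 1
  · rw [completeUpTo]
    refine Finset.sum_congr ?_ fun _ _ => rfl
    ext f
    simp only [Finset.mem_filter, Finset.mem_univ, true_and]
    constructor
    · rintro ⟨⟨hf, h1⟩, h2⟩
      refine ⟨hf, fun t => ?_⟩
      have h3 : (f t : ℕ) ≤ f (Fin.last k) := hf (Fin.le_last t)
      have h4 := h1 (Fin.last k)
      have h5 : (f (Fin.last k) : ℕ) ≠ i := fun h => h2 (Fin.ext h)
      omega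
    · rintro ⟨hf, h1⟩
      refine ⟨⟨hf, fun t => (h1 t).trans (Nat.lt_succ_self _)⟩, fun h => ?_⟩
      have := h1 (Fin.last k)
      rw [h] at this
      exact this.false
  · rw [completeUpTo, Finset.sum_mul]
    refine Finset.sum_bij' (fun f _ => Fin.init f) (fun g _ => Fin.snoc g i) ?_ ?_ ?_ ?_ ?_
    · intro f hf
      simp only [Finset.mem_filter, Finset.mem_univ, true_and] at hf ⊢
      exact ⟨fun a b hab => hf.1.1 (Fin.castSucc_le_castSucc_iff.2 hab), fun t => hf.1.2 _⟩
    · intro g hg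
      simp only [Finset.mem_filter, Finset.mem_univ, true_and, not_not, Fin.snoc_last,
        and_true] at hg ⊢
      refine ⟨fun a b hab => ?_, fun t => ?_⟩
      · induction b using Fin.lastCases with
        | last =>
          rw [Fin.snoc_last]
          induction a using Fin.lastCases with
          | last => rw [Fin.snoc_last]
          | cast a =>
            rw [Fin.snoc_castSucc, Fin.le_def]
            exact Nat.lt_succ_iff.1 (hg.2 a)
        | cast b =>
          induction a using Fin.lastCases with
          | last => exact absurd hab (not_le.2 (Fin.castSucc_lt_last b))
          | cast a =>
            rw [Fin.snoc_castSucc, Fin.snoc_castSucc]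
            exact hg.1 (Fin.castSucc_le_castSucc_iff.1 hab)
      · induction t using Fin.lastCases with
        | last => rw [Fin.snoc_last]; exact Nat.lt_succ_self _
        | cast t => rw [Fin.snoc_castSucc]; exact hg.2 t
    · intro f hf
      simp only [Finset.mem_filter, not_not] at hf
      rw [← hf.2, Fin.snoc_init_self]
    · intro g _
      exact Fin.init_snoc _ _
    · intro f hf
      simp only [Finset.mem_filter, not_not] at hf
      rw [List.ofFn_succ', List.concat_eq_append, List.prod_append, List.prod_singleton, hf.2]
      rfl

theorem commute_completeUpTo {x : Fin n → R} (hx : ∀ i j, Commute (x i) (x j)) (i : Fin n)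
    (m k : ℕ) : Commute (x i) (completeUpTo x m k) := by
  refine Commute.sum_right _ _ _ fun f _ => Commute.list_prod_right _ _ fun y hy => ?_
  obtain ⟨t, rfl⟩ := List.mem_ofFn.1 hy
  exact hx _ _

theorem completeUpTo_succ_succ' {x : Fin n → R} (hx : ∀ i j, Commute (x i) (x j)) (i : Fin n)
    (k : ℕ) : completeUpTo x (i + 1) (k + 1) =
      completeUpTo x i (k + 1) + x i * completeUpTo x (i + 1) k := by
  rw [completeUpTo_succ_succ, (commute_completeUpTo hx i _ k).eq]

/-- The elementary symmetric function of degree `k` in the first `m` of the `x_i`. -/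
def elemUpTo (x : Fin n → R) : ℕ → ℕ → R
  | _, 0 => 1
  | 0, _ + 1 => 0
  | m + 1, k + 1 => elemUpTo x m (k + 1) +
      -- The value 0 only fills in for variables beyond the last one.
      (if h : m < n then x ⟨m, h⟩ else 0) * elemUpTo x m k

theorem elemUpTo_zero_right (x : Fin n → R) (m : ℕ) : elemUpTo x m 0 = 1 := by
  cases m <;> rfl

theorem elemUpTo_zero_succ (x : Fin n → R) (k : ℕ) : elemUpTo x 0 (k + 1) = 0 := rfl

theorem elemUpTo_succ_succ (x : Fin n → R) (i : Fin n) (k : ℕ) :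
    elemUpTo x (i + 1) (k + 1) = elemUpTo x i (k + 1) + x i * elemUpTo x i k := by
  rw [elemUpTo, dif_pos i.2]

open PowerSeries in
-- Complete functions take the new variable on the right and elementary ones on the left, so the
-- factor $1 - x_iX$ sits between the two series and telescopes without any commutativity.
theorem mk_completeUpTo_mul_mk_elemUpTo (x : Fin n → R) (m : ℕ) (hm : m ≤ n) :
    (PowerSeries.mk fun k => completeUpTo x m k) *
      (PowerSeries.mk fun k => (-1) ^ k * elemUpTo x m k) = 1 := by
  induction m with
  | zero =>
    have h1 : (PowerSeries.mk fun k => completeUpTo x 0 k) = 1 := by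
      ext k
      cases k with
      | zero => simp [completeUpTo_zero_right]
      | succ k => simp [completeUpTo_zero_succ, coeff_one]
    have h2 : (PowerSeries.mk fun k => (-1) ^ k * elemUpTo x 0 k) = 1 := by
      ext k
      cases k with
      | zero => simp [elemUpTo_zero_right]
      | succ k => simp [elemUpTo_zero_succ, coeff_one]
    rw [h1, h2, one_mul]
  | succ m ih =>
    obtain ⟨i, rfl⟩ : ∃ i : Fin n, (i : ℕ) = m := ⟨⟨m, hm⟩, rfl⟩
    have h1 : (PowerSeries.mk fun k => completeUpTo x i k) =
        (PowerSeries.mk fun k => completeUpTo x (i + 1) k) * (1 - C (x i) * X) := by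
      rw [mul_sub, mul_one, ← mul_assoc]
      ext k
      cases k with
      | zero => simp [completeUpTo_zero_right]
      | succ k =>
        rw [map_sub, coeff_succ_mul_X, coeff_mul_C, coeff_mk, coeff_mk, coeff_mk,
          completeUpTo_succ_succ, add_sub_cancel_right]
    have h2 : (PowerSeries.mk fun k => (-1) ^ k * elemUpTo x (i + 1) k) =
        (1 - C (x i) * X) * (PowerSeries.mk fun k => (-1) ^ k * elemUpTo x i k) := by
      rw [sub_mul, one_mul, mul_assoc]
      ext k
      cases k with
      | zero => simp [elemUpTo_zero_right]
      | succ k =>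
        rw [map_sub, coeff_C_mul, coeff_succ_X_mul, coeff_mk, coeff_mk, coeff_mk,
          elemUpTo_succ_succ, pow_succ, mul_add, ← mul_assoc (x i),
          ((Commute.neg_one_right (x i)).pow_right k).eq]
        noncomm_ring
    rw [h2, ← mul_assoc, ← h1, ih (by omega)]

theorem sum_antidiagonal_completeUpTo_mul_elemUpTo (x : Fin n → R) (k : ℕ) :
    ∑ p ∈ Finset.HasAntidiagonal.antidiagonal (k + 1),
      completeUpTo x n p.1 * ((-1) ^ p.2 * elemUpTo x n p.2) = 0 := by
  have := congrArg (PowerSeries.coeff (k + 1)) (mk_completeUpTo_mul_mk_elemUpTo x n le_rfl)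
  simpa [PowerSeries.coeff_mul, PowerSeries.coeff_one] using this

end SymmetricFunctions

/-! ### The Catalan recursion for top coefficients -/

section TopCoefficients

variable {n : ℕ}

open Equiv Equiv.Perm

/-- The transposition `(j a)` in terms of a representative in `S_n` of the double coset. -/
theorem cosetType_swap_mul_eq {σ h h' : Sym2n n} {a : Fin n} {w : Perm (Fin n)}
    (hh : h ∈ hyperoctahedral n) (hh' : h' ∈ hyperoctahedral n) (ha : h (a, false) = (a, false))
    (hw : h * σ * h' = levelPerm false w) (j : Pt n) :
    cosetType (swap j (a, false) * σ) = cosetType (swap (h j) (a, false) * levelPerm false w) := by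
  rw [← cosetType_mul_mul _ hh hh', ← hw]
  congr 1
  rw [← mul_assoc, mul_swap_eq_swap_mul, ha]
  simp only [mul_assoc]

/-- For the representative `w` in $S_n$, the partner of `(a, true)` is `(w a, false)`, so the
transposition cuts the cycle of `a`. -/
theorem card_parts_cosetType_swap_matching (σ : Sym2n n) (a : Fin n)
    (ha : matching σ (a, true) ≠ (a, false)) :
    Multiset.card (cosetType (swap (matching σ (a, true)) (a, false) * σ)).parts =
      Multiset.card (cosetType σ).parts + 1 := by
  obtain ⟨h, hh, h', hh', w, hfix, hw⟩ := exists_eq_levelPerm σ a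
  have hfix' : h (a, true) = (a, true) := by
    have := (mem_hyperoctahedral_iff h).1 hh (a, false)
    rwa [hfix] at this
  have hj : h (matching σ (a, true)) = (w a, false) := by
    rw [← matching_levelPerm_false, ← hw, matching_mul_right _ hh', matching_mul_left, mul_apply,
      mul_apply, eq_comm, inv_eq_iff_eq.2 hfix'.symm]
  have hwa : w a ≠ a := by
    intro hwa
    rw [hwa, ← hfix] at hj
    exact ha (h.injective hj)
  rw [cosetType_swap_mul_eq hh hh' hfix hw, hj, swap_mul_levelPerm, ← cosetType_mul_mul σ hh hh',
    hw, parts_cosetType_levelPerm, parts_cosetType_levelPerm]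
  exact card_parts_swap_mul_of_sameCycle (sameCycle_apply_right.2 (SameCycle.refl _ _)) hwa

theorem card_partition_parts_eq_iff (w : Perm (Fin n)) :
    Multiset.card w.partition.parts = n ↔ w = 1 := by
  rw [parts_partition, ← sum_cycleType, Multiset.card_add, Multiset.card_replicate,
    Fintype.card_fin, ← card_cycleType_eq_zero]
  have h1 := w.sum_cycleType_le
  have h2 : Multiset.card w.cycleType • 2 ≤ w.cycleType.sum :=
    Multiset.card_nsmul_le_sum fun x hx => two_le_of_mem_cycleType hx
  rw [Fintype.card_fin] at h1
  rw [smul_eq_mul] at h2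
  have h3 : Multiset.card w.cycleType = 0 → w.cycleType.sum = 0 := fun h => by
    rw [Multiset.card_eq_zero.1 h, Multiset.sum_zero]
  omega

theorem levelPerm_one (c : Bool) : levelPerm c (1 : Perm (Fin n)) = 1 :=
  extendDomain_one _

theorem parts_cosetType_of_mem {σ : Sym2n n} (hσ : σ ∈ hyperoctahedral n) :
    (cosetType σ).parts = Multiset.replicate n 1 := by
  rw [← one_mul σ, cosetType_mul_right _ hσ, ← levelPerm_one false, parts_cosetType_levelPerm,
    parts_partition]
  simp

theorem mem_hyperoctahedral_iff_card_parts (σ : Sym2n n) :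
    σ ∈ hyperoctahedral n ↔ Multiset.card (cosetType σ).parts = n := by
  constructor
  · intro hσ
    rw [parts_cosetType_of_mem hσ, Multiset.card_replicate]
  · intro hσ
    obtain ⟨h, hh, h', hh', w, hw⟩ := exists_eq_levelPerm' σ
    rw [← cosetType_mul_mul σ hh hh', hw, parts_cosetType_levelPerm, card_partition_parts_eq_iff]
      at hσ
    rw [hσ, levelPerm_one] at hw
    have : σ = h⁻¹ * h'⁻¹ := by
      rw [eq_mul_inv_iff_mul_eq, eq_inv_iff_mul_eq_one, mul_eq_one_iff_inv_eq',
        ← mul_eq_one_iff_inv_eq,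
        ← mul_assoc, hw]
    rw [this]
    exact mul_mem (inv_mem hh) (inv_mem hh')

/-- The coefficient of a permutation of coset-type `s` in `h_k(J_1, …, J_n) p_n`, when
`n - ℓ(s) ≥ k`. -/
def topCoeff (n k : ℕ) (s : Multiset ℕ) : ℤ :=
  if k + Multiset.card s = n then (s.map fun r => (catalan (r - 1) : ℤ)).prod else 0

/-- The Catalan recursion, reindexed by the lengths $i$ and $m-i$ of the two pieces of a cut cycle.
-/
theorem sum_catalan (m : ℕ) (hm : 2 ≤ m) :
    ∑ i ∈ Finset.Ioo 0 m, (catalan (i - 1) : ℤ) * catalan (m - i - 1) = catalan (m - 1) := by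
  obtain ⟨m, rfl⟩ : ∃ k, m = k + 2 := ⟨m - 2, by omega⟩
  rw [show m + 2 - 1 = m + 1 from rfl, catalan_succ', Finset.Nat.sum_antidiagonal_eq_sum_range_succ
    (fun i j => catalan i * catalan j)]
  push_cast
  refine Finset.sum_bij' (fun i _ => i - 1) (fun i _ => i + 1) ?_ ?_ ?_ ?_ ?_
  · intro i hi
    rw [Finset.mem_Ioo] at hi
    rw [Finset.mem_range]
    omega
  · intro i hi
    rw [Finset.mem_range] at hi
    rw [Finset.mem_Ioo]
    omega
  · intro i hi
    rw [Finset.mem_Ioo] at hi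
    omega
  · intro i _
    rfl
  · intro i hi
    rw [Finset.mem_Ioo] at hi
    rw [show m + 2 - i - 1 = m - (i - 1) by omega]

/-- A point `b` outside the cycle of `a` merges two cycles and leaves too few parts to contribute.
The points $w^i a$ with $0<i<m$ give each cut of the cycle once, and `sum_catalan` adds up the
products. -/
theorem sum_topCoeff_swap_mul (w : Perm (Fin n)) (a : Fin n) (ha : w a ≠ a) (k : ℕ)
    (hk : k + 1 + Multiset.card w.partition.parts ≤ n) :
    ∑ b : Fin n with b ≠ a, topCoeff n k (swap b a * w).partition.parts =
      topCoeff n (k + 1) w.partition.parts := by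
  set m := (w.cycleOf a).support.card with hm
  have hm2 : 2 ≤ m := ((isCycle_cycleOf_iff w).2 ha).two_le_card_support
  have hmem : m ∈ w.partition.parts := by
    have h := parts_partition_swap_mul w a one_pos (by omega)
    rw [← hm] at h
    have h' : m ∈ w.partition.parts + {1, m - 1} := by
      rw [← h]
      simp
    simp only [Multiset.mem_add, Multiset.insert_eq_cons, Multiset.mem_cons,
      Multiset.mem_singleton] at h'
    rcases h' with h' | h' | h'
    · exact h'
    · omega
    · omega
  have hinj : ∀ i < m, ∀ j < m, (w ^ i) a = (w ^ j) a → i = j := by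
    intro i hi j hj hij
    have h := (nodup_toList w a).getElem_inj_iff (i := i) (j := j)
      (hi := by rw [length_toList]; exact hi) (hj := by rw [length_toList]; exact hj)
    rw [getElem_toList, getElem_toList] at h
    exact h.1 hij
  obtain ⟨R, hR⟩ := Multiset.exists_cons_of_mem hmem
  have hsplit : ∀ i ∈ Finset.Ioo 0 m,
      (swap ((w ^ i) a) a * w).partition.parts = R + {i, m - i} := by
    intro i hi
    rw [Finset.mem_Ioo] at hi
    have h := parts_partition_swap_mul w a hi.1 hi.2
    rw [← hm, hR, ← Multiset.singleton_add, add_comm, add_assoc] at h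
    exact add_left_cancel h
  have hsum : ∑ b : Fin n with b ≠ a, topCoeff n k (swap b a * w).partition.parts =
      ∑ i ∈ Finset.Ioo 0 m, topCoeff n k (R + {i, m - i}) := by
    symm
    rw [← Finset.sum_subset (s₁ := Finset.univ.filter fun b => b ≠ a ∧ w.SameCycle a b)]
    · refine Finset.sum_bij (fun i _ => (w ^ i) a) ?_ ?_ ?_ ?_
      · intro i hi
        have hi' := Finset.mem_Ioo.1 hi
        rw [Finset.mem_filter]
        refine ⟨Finset.mem_univ _, fun h => ?_, i, by rw [zpow_natCast]⟩
        exact hi'.1.ne' (hinj i hi'.2 0 (by omega) h)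
      · intro i hi j hj hij
        rw [Finset.mem_Ioo] at hi hj
        exact hinj i hi.2 j hj.2 hij
      · intro b hb
        rw [Finset.mem_filter] at hb
        obtain ⟨i, hi, him, hib⟩ := exists_pow_eq_of_sameCycle_of_ne hb.2.2 hb.2.1
        exact ⟨i, Finset.mem_Ioo.2 ⟨hi, him⟩, hib⟩
      · intro i hi
        rw [hsplit i hi]
    · intro b hb
      rw [Finset.mem_filter] at hb ⊢
      exact ⟨hb.1, hb.2.1⟩
    · intro b hb hb'
      rw [Finset.mem_filter] at hb hb'
      have := card_parts_swap_mul_of_not_sameCycle (w := w) (a := a) (b := b)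
        fun h => hb' ⟨hb.1, hb.2, h⟩
      rw [topCoeff, if_neg (by omega)]
  rw [hsum, topCoeff, hR]
  have hcard : Multiset.card w.partition.parts = Multiset.card R + 1 := by
    rw [hR, Multiset.card_cons]
  by_cases hkn : k + 1 + (Multiset.card R + 1) = n
  · rw [if_pos (by rw [Multiset.card_cons]; exact hkn), Multiset.map_cons, Multiset.prod_cons,
      ← sum_catalan m hm2, Finset.sum_mul]
    refine Finset.sum_congr rfl fun i _ => ?_
    rw [topCoeff, if_pos (by simp; omega)]
    simp
    ring
  · rw [if_neg (by rw [Multiset.card_cons]; exact hkn)]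
    refine Finset.sum_eq_zero fun i _ => ?_
    rw [topCoeff, if_neg (by simp; omega)]

theorem matchingProd_levelPerm_apply_snd (w : Perm (Fin n)) (x : Pt n) :
    (matchingProd (levelPerm false w) x).2 = x.2 := by
  rw [matchingProd_levelPerm, mul_apply, levelPerm_apply, levelPerm_apply]

theorem sum_topCoeff_cosetType_swap_mul (σ : Sym2n n) (a : Fin n)
    (ha : matching σ (a, true) ≠ (a, false)) (k : ℕ)
    (hk : k + 1 + Multiset.card (cosetType σ).parts ≤ n) :
    ∑ j : Pt n with j.1 ≠ a, topCoeff n k (cosetType (swap j (a, false) * σ)).parts =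
      topCoeff n (k + 1) (cosetType σ).parts := by
  obtain ⟨h, hh, h', hh', w, hfix, hw⟩ := exists_eq_levelPerm σ a
  have hfix' : h (a, true) = (a, true) := by
    have := (mem_hyperoctahedral_iff h).1 hh (a, false)
    rwa [hfix] at this
  have htype : (cosetType σ).parts = w.partition.parts := by
    rw [← cosetType_mul_mul σ hh hh', hw, parts_cosetType_levelPerm]
  have hj : h (matching σ (a, true)) = (w a, false) := by
    rw [← matching_levelPerm_false, ← hw, matching_mul_right _ hh', matching_mul_left, mul_apply,
      mul_apply, eq_comm, inv_eq_iff_eq.2 hfix'.symm]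
  have hwa : w a ≠ a := by
    intro hwa
    rw [hwa, ← hfix] at hj
    exact ha (h.injective hj)
  rw [htype] at hk ⊢
  have hfst : ∀ x : Pt n, (h x).1 ≠ a ↔ x.1 ≠ a := by
    have key : ∀ x : Pt n, x.1 = a ↔ x = (a, false) ∨ x = (a, true) := by
      rintro ⟨i, b⟩
      cases b <;> simp
    intro x
    have e : ∀ y, h y = y → (h x = y ↔ x = y) := fun y hy =>
      ⟨fun hxy => h.injective (hxy.trans hy.symm), fun hxy => by rw [hxy, hy]⟩
    rw [not_iff_not, key, key, e _ hfix, e _ hfix']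
  rw [← sum_topCoeff_swap_mul w a hwa k hk,
    Finset.sum_equiv h (t := Finset.univ.filter fun j : Pt n => j.1 ≠ a)
      (g := fun j => topCoeff n k (cosetType (swap j (a, false) * levelPerm false w)).parts)
      (by simp [hfst]) (fun j _ => by rw [cosetType_swap_mul_eq hh hh' hfix hw])]
  -- The product of matchings preserves levels, so `(a, false)` and `(b, true)` are in different
  -- cycles and no part is gained.
  have hzero : ∀ b, topCoeff n k
      (cosetType (swap (b, true) (a, false) * levelPerm false w)).parts = 0 := by
    intro b
    have := card_parts_cosetType_swap_mul_le_of_not_sameCycle (levelPerm false w)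
      (x := (a, false)) (y := (b, true)) (by
        intro hsc
        obtain ⟨l, hl⟩ := hsc.exists_nat_pow_eq
        have hl2 : ∀ l : ℕ, ((matchingProd (levelPerm false w) ^ l) (a, false)).2 = false := by
          intro l
          induction l with
          | zero => rfl
          | succ l ih => rw [pow_succ', mul_apply, matchingProd_levelPerm_apply_snd, ih]
        have := hl2 l
        rw [hl] at this
        exact absurd this (by simp))
    rw [parts_cosetType_levelPerm] at this
    rw [topCoeff, if_neg (by omega)]
  rw [Finset.sum_filter, Finset.sum_filter, Fintype.sum_prod_type]
  refine Finset.sum_congr rfl fun b _ => ?_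
  rw [Fintype.sum_bool, hzero, swap_mul_levelPerm, parts_cosetType_levelPerm]
  simp

end TopCoefficients

/-! ### Coefficients of symmetric functions of the Jucys–Murphy elements times $p_n$ -/

section Coefficients

variable {n : ℕ}

open Equiv Equiv.Perm

theorem coeff_perm (σ τ : Sym2n n) : (perm σ).coeff τ = if σ = τ then 1 else 0 := by
  classical
  rw [perm, MonoidAlgebra.of_apply, MonoidAlgebra.coeff_single, Finsupp.single_apply]

theorem coeff_perm_mul (τ : Sym2n n) (y : GrpAlg n) (σ : Sym2n n) :
    (perm τ * y).coeff σ = y.coeff (τ⁻¹ * σ) := by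
  rw [perm, MonoidAlgebra.of_apply, MonoidAlgebra.coeff_single_mul_apply, one_mul]

theorem coeff_mul_perm (τ : Sym2n n) (y : GrpAlg n) (σ : Sym2n n) :
    (y * perm τ).coeff σ = y.coeff (σ * τ⁻¹) := by
  rw [perm, MonoidAlgebra.of_apply, MonoidAlgebra.coeff_mul_single_apply, mul_one]

open scoped Classical in
theorem coeff_sum_perm (P : Sym2n n → Prop) (σ : Sym2n n) :
    (∑ τ : Sym2n n with P τ, perm τ).coeff σ = if P σ then 1 else 0 := by
  rw [MonoidAlgebra.coeff_sum, Finsupp.finsetSum_apply]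
  simp only [coeff_perm]
  rw [Finset.sum_ite_eq']
  simp

open scoped Classical in
theorem coeff_pElt (σ : Sym2n n) : (pElt n).coeff σ = if σ ∈ hyperoctahedral n then 1 else 0 := by
  rw [pElt]
  convert coeff_sum_perm (· ∈ hyperoctahedral n) σ

open scoped Classical in
theorem coeff_classSum (μ : n.Partition) (σ : Sym2n n) :
    (classSum μ).coeff σ = if cosetType σ = μ then 1 else 0 := by
  rw [classSum]
  convert coeff_sum_perm (fun σ => cosetType σ = μ) σ

theorem coeff_oddJucysMurphy_mul (i : Fin n) (y : GrpAlg n) (σ : Sym2n n) :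
    (oddJucysMurphy i * y).coeff σ =
      ∑ j : Pt n with j.1 < i, y.coeff (swap j (i, false) * σ) := by
  rw [oddJucysMurphy, Finset.sum_mul, MonoidAlgebra.coeff_sum, Finsupp.finsetSum_apply]
  simp only [coeff_perm_mul, swap_inv]

/-- The matching of `σ` pairs `i` with `ī` for all but the first `m` values of `i`. -/
def TrivialFrom (σ : Sym2n n) (m : ℕ) : Prop :=
  ∀ x : Pt n, m ≤ x.1 → matching σ x = bar x

theorem TrivialFrom.mono {σ : Sym2n n} {m m' : ℕ} (h : TrivialFrom σ m) (hm : m ≤ m') :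
    TrivialFrom σ m' :=
  fun x hx => h x (hm.trans hx)

theorem trivialFrom_zero_iff (σ : Sym2n n) : TrivialFrom σ 0 ↔ σ ∈ hyperoctahedral n := by
  have h1 : matching (1 : Sym2n n) = barPerm n := by simp [matching]
  rw [← inv_mem_iff, ← mul_one σ⁻¹, ← matching_eq_iff, h1]
  exact ⟨fun h => Equiv.ext fun x => h x (Nat.zero_le _), fun h x _ => by rw [h]; rfl⟩

theorem trivialFrom_of_mem {σ : Sym2n n} (h : σ ∈ hyperoctahedral n) (m : ℕ) : TrivialFrom σ m :=
  ((trivialFrom_zero_iff σ).2 h).mono (Nat.zero_le m)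

theorem matching_swap_mul (σ : Sym2n n) (x y z : Pt n) :
    matching (swap x y * σ) z = swap x y (matching σ (swap x y z)) := by
  rw [matching_mul_left, swap_inv]
  rfl

theorem trivialFrom_iff {σ : Sym2n n} (i : Fin n) (h : TrivialFrom σ (i + 1)) :
    TrivialFrom σ i ↔ matching σ (i, true) = (i, false) := by
  constructor
  · intro h'
    exact h' (i, true) le_rfl
  · rintro h' ⟨j, b⟩ hj
    rcases eq_or_lt_of_le hj with hij | hij
    · obtain rfl : i = j := Fin.ext hij
      cases b
      · exact (congrArg (matching σ) h').symm.trans (matching_matching_apply σ _)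
      · exact h'
    · exact h _ hij

theorem TrivialFrom.swap_mul {σ : Sym2n n} {i : Fin n} (h : TrivialFrom σ (i + 1)) {j : Pt n}
    (hj : j.1 < i) : TrivialFrom (swap j (i, false) * σ) (i + 1) := by
  have hne : ∀ x : Pt n, (i : ℕ) + 1 ≤ x.1 → swap j (i, false) x = x := by
    intro x hx
    refine swap_apply_of_ne_of_ne ?_ ?_
    · rintro rfl
      have : (x.1 : ℕ) < i := hj
      omega
    · rintro rfl
      simp at hx
  intro x hx
  rw [matching_swap_mul, hne x hx, h x hx, hne (bar x) hx]

theorem trivialFrom_swap_mul_iff {σ : Sym2n n} {i : Fin n} {j : Pt n} (hj : j.1 < i) :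
    TrivialFrom (swap j (i, false) * σ) (i + 1) ↔ TrivialFrom σ (i + 1) := by
  refine ⟨fun h => ?_, fun h => h.swap_mul hj⟩
  have := h.swap_mul hj
  rwa [swap_mul_self_mul] at this

theorem coeff_completeUpTo_succ (i : Fin n) (k : ℕ) (σ : Sym2n n) :
    (completeUpTo (oddJucysMurphy (n := n)) (i + 1) (k + 1) * pElt n).coeff σ =
      (completeUpTo (oddJucysMurphy (n := n)) i (k + 1) * pElt n).coeff σ +
      ∑ j : Pt n with j.1 < i, (completeUpTo (oddJucysMurphy (n := n)) (i + 1) k * pElt n).coeff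
        (swap j (i, false) * σ) := by
  rw [completeUpTo_succ_succ' oddJucysMurphy_commute, add_mul, mul_assoc, MonoidAlgebra.coeff_add,
    Finsupp.add_apply, coeff_oddJucysMurphy_mul]

theorem coeff_elemUpTo_succ (i : Fin n) (k : ℕ) (σ : Sym2n n) :
    (elemUpTo (oddJucysMurphy (n := n)) (i + 1) (k + 1) * pElt n).coeff σ =
      (elemUpTo (oddJucysMurphy (n := n)) i (k + 1) * pElt n).coeff σ +
      ∑ j : Pt n with j.1 < i, (elemUpTo (oddJucysMurphy (n := n)) i k * pElt n).coeff
        (swap j (i, false) * σ) := by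
  rw [elemUpTo_succ_succ, add_mul, mul_assoc, MonoidAlgebra.coeff_add,
    Finsupp.add_apply, coeff_oddJucysMurphy_mul]

/-- The first `m` Jucys–Murphy elements only involve transpositions of points of index below `m`,
and these leave the other pairs of the matching alone. -/
theorem coeff_completeUpTo_eq_zero (m : ℕ) (hm : m ≤ n) (k : ℕ) (σ : Sym2n n)
    (hσ : ¬ TrivialFrom σ m) :
    (completeUpTo (oddJucysMurphy (n := n)) m k * pElt n).coeff σ = 0 := by
  induction m generalizing k σ with
  | zero =>
    cases k with
    | zero =>
      rw [completeUpTo_zero_right, one_mul, coeff_pElt, if_neg]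
      exact fun h => hσ (trivialFrom_of_mem h _)
    | succ k =>
      rw [completeUpTo_zero_succ, zero_mul]
      rfl
  | succ m ih =>
    obtain ⟨i, rfl⟩ : ∃ i : Fin n, (i : ℕ) = m := ⟨⟨m, hm⟩, rfl⟩
    induction k generalizing σ with
    | zero =>
      rw [completeUpTo_zero_right, one_mul, coeff_pElt, if_neg]
      exact fun h => hσ (trivialFrom_of_mem h _)
    | succ k ihk =>
      rw [coeff_completeUpTo_succ, ih (by omega) _ _ fun h => hσ (h.mono (Nat.le_succ _)), zero_add]
      refine Finset.sum_eq_zero fun j hj => ihk _ ?_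
      rwa [trivialFrom_swap_mul_iff (Finset.mem_filter.1 hj).2]

theorem coeff_elemUpTo_eq_zero (m : ℕ) (hm : m ≤ n) (k : ℕ) (σ : Sym2n n)
    (hσ : ¬ TrivialFrom σ m) :
    (elemUpTo (oddJucysMurphy (n := n)) m k * pElt n).coeff σ = 0 := by
  induction m generalizing k σ with
  | zero =>
    cases k with
    | zero =>
      rw [elemUpTo_zero_right, one_mul, coeff_pElt, if_neg]
      exact fun h => hσ (trivialFrom_of_mem h _)
    | succ k =>
      rw [elemUpTo_zero_succ, zero_mul]
      rfl
  | succ m ih =>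
    obtain ⟨i, rfl⟩ : ∃ i : Fin n, (i : ℕ) = m := ⟨⟨m, hm⟩, rfl⟩
    cases k with
    | zero =>
      rw [elemUpTo_zero_right, one_mul, coeff_pElt, if_neg]
      exact fun h => hσ (trivialFrom_of_mem h _)
    | succ k =>
      rw [coeff_elemUpTo_succ, ih (by omega) _ _ fun h => hσ (h.mono (Nat.le_succ _)), zero_add]
      refine Finset.sum_eq_zero fun j hj => ih (by omega) _ _ fun h => hσ ?_
      exact (trivialFrom_swap_mul_iff (Finset.mem_filter.1 hj).2).1 (h.mono (Nat.le_succ _))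

/-- Only the transposition of `(i, false)` with the current partner of `(i, true)` can pair these
two points. This leaves at most one term in the elementary recursion. -/
theorem not_trivialFrom_swap_mul {σ : Sym2n n} {i : Fin n} {j : Pt n} (hj : j.1 < i)
    (h : matching σ (i, true) ≠ j) : ¬ TrivialFrom (swap j (i, false) * σ) i := by
  intro ht
  have h1 := ht (i, true) le_rfl
  have hne : ∀ b, (i, b) ≠ j := by
    rintro b rfl
    exact hj.false
  rw [matching_swap_mul, swap_apply_of_ne_of_ne (hne true) (by simp), swap_apply_eq_iff] at h1
  exact h (h1.trans (swap_apply_right _ _))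

/-- Points of larger index are already paired with their bars, so the partner has a smaller index.
-/
theorem matching_fst_lt {σ : Sym2n n} {i : Fin n} (h : TrivialFrom σ (i + 1))
    (hi : matching σ (i, true) ≠ (i, false)) : (matching σ (i, true)).1 < i := by
  by_contra hlt
  rcases eq_or_lt_of_le (not_lt.1 hlt) with heq | hlt
  · have h2 : matching σ (i, true) = (i, true) ∨ matching σ (i, true) = (i, false) := by
      generalize matching σ (i, true) = y at *
      rcases y with ⟨j, b⟩
      obtain rfl : i = j := heq
      cases b <;> simp
    exact h2.elim (matching_apply_ne _ _) hi
  · have h3 := h (matching σ (i, true)) hlt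
    rw [matching_matching_apply] at h3
    have h4 := congrArg Prod.fst h3
    exact hlt.ne h4

/-- The elementary symmetric functions of the odd Jucys-Murphy elements. -/
theorem coeff_elemUpTo (m : ℕ) (hm : m ≤ n) (k : ℕ) (σ : Sym2n n) (hσ : TrivialFrom σ m) :
    (elemUpTo (oddJucysMurphy (n := n)) m k * pElt n).coeff σ =
      if k + Multiset.card (cosetType σ).parts = n then 1 else 0 := by
  induction m generalizing k σ with
  | zero =>
    have hmem := (trivialFrom_zero_iff σ).1 hσ
    have hcard := (mem_hyperoctahedral_iff_card_parts σ).1 hmem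
    cases k with
    | zero =>
      rw [elemUpTo_zero_right, one_mul, coeff_pElt, if_pos hmem, if_pos (by omega)]
    | succ k =>
      rw [elemUpTo_zero_succ, zero_mul, if_neg (by omega)]
      rfl
  | succ m ih =>
    obtain ⟨i, rfl⟩ : ∃ i : Fin n, (i : ℕ) = m := ⟨⟨m, hm⟩, rfl⟩
    cases k with
    | zero =>
      rw [elemUpTo_zero_right, one_mul, coeff_pElt, zero_add]
      classical
      exact if_congr (mem_hyperoctahedral_iff_card_parts σ) rfl rfl
    | succ k =>
      rw [coeff_elemUpTo_succ]
      by_cases hi : matching σ (i, true) = (i, false)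
      · rw [ih (by omega) _ _ ((trivialFrom_iff i hσ).2 hi), Finset.sum_eq_zero, add_zero]
        intro j hj
        have hj' := (Finset.mem_filter.1 hj).2
        refine coeff_elemUpTo_eq_zero _ (by omega) _ _ (not_trivialFrom_swap_mul hj' ?_)
        rw [hi]
        rintro rfl
        exact hj'.false
      -- The single surviving transposition does occur in $J_i$, and it adds exactly one part,
      -- matching the drop from `k + 1` to `k`.
      · have hlt := matching_fst_lt hσ hi
        rw [coeff_elemUpTo_eq_zero _ (by omega) _ _ (mt (trivialFrom_iff i hσ).1 hi), zero_add,
          Finset.sum_eq_single (matching σ (i, true)), ih (by omega),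
          card_parts_cosetType_swap_matching σ i hi]
        · simp only [add_assoc, add_comm 1]
        · rw [trivialFrom_iff i (hσ.swap_mul hlt), matching_swap_mul, swap_apply_of_ne_of_ne
            (matching_apply_ne _ _).symm (by simp), swap_apply_left]
        · intro j hj hne
          exact coeff_elemUpTo_eq_zero _ (by omega) _ _
            (not_trivialFrom_swap_mul (Finset.mem_filter.1 hj).2 hne.symm)
        · intro h
          exact (h (Finset.mem_filter.2 ⟨Finset.mem_univ _, hlt⟩)).elim

/-- A point paired with its bar is fixed by `matchingProd σ`, hence alone in its cycle. -/
theorem card_parts_cosetType_swap_mul_le_of_matching_eq (σ : Sym2n n) {x y : Pt n} (hxy : x ≠ y)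
    (h : matching σ x = bar x ∨ matching σ y = bar y) :
    Multiset.card (cosetType (swap y x * σ)).parts ≤ Multiset.card (cosetType σ).parts := by
  refine card_parts_cosetType_swap_mul_le_of_not_sameCycle σ fun hsc => hxy ?_
  have hfix : ∀ z : Pt n, matching σ z = bar z → matchingProd σ z = z := fun z hz => by
    rw [matchingProd_apply, hz, bar_bar]
  exact h.elim (fun h => hsc.eq_of_left (hfix x h)) fun h => hsc.eq_of_right (hfix y h)

theorem topCoeff_zero_of_mem {σ : Sym2n n} (hσ : σ ∈ hyperoctahedral n) :
    topCoeff n 0 (cosetType σ).parts = 1 := by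
  rw [topCoeff, parts_cosetType_of_mem hσ, if_pos (by simp)]
  simp

theorem coeff_pElt_eq_topCoeff (σ : Sym2n n) :
    (pElt n).coeff σ = topCoeff n 0 (cosetType σ).parts := by
  rw [coeff_pElt]
  split_ifs with h
  · rw [topCoeff_zero_of_mem h]
  · rw [topCoeff, if_neg]
    rwa [zero_add, ← mem_hyperoctahedral_iff_card_parts]

/-- The coefficients of the complete symmetric functions at the permutations of coset-type `ρ`
with `n - ℓ(ρ) ≥ k`. -/
theorem coeff_completeUpTo (m : ℕ) (hm : m ≤ n) (k : ℕ) (σ : Sym2n n) (hσ : TrivialFrom σ m)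
    (hk : k + Multiset.card (cosetType σ).parts ≤ n) :
    (completeUpTo (oddJucysMurphy (n := n)) m k * pElt n).coeff σ =
      topCoeff n k (cosetType σ).parts := by
  induction m generalizing k σ with
  | zero =>
    cases k with
    | zero => rw [completeUpTo_zero_right, one_mul, coeff_pElt_eq_topCoeff]
    | succ k =>
      have := (mem_hyperoctahedral_iff_card_parts σ).1 ((trivialFrom_zero_iff σ).1 hσ)
      omega
  | succ m ih =>
    obtain ⟨i, rfl⟩ : ∃ i : Fin n, (i : ℕ) = m := ⟨⟨m, hm⟩, rfl⟩
    induction k generalizing σ with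
    | zero => rw [completeUpTo_zero_right, one_mul, coeff_pElt_eq_topCoeff]
    | succ k ihk =>
      rw [coeff_completeUpTo_succ, Finset.sum_congr rfl fun j hj => ihk (swap j (i, false) * σ)
        (by have := card_parts_cosetType_swap_mul_le σ (i, false) j; omega)
        (hσ.swap_mul (Finset.mem_filter.1 hj).2)]
      -- If `i` is paired with its bar, no transposition gains a part, so the sum vanishes and fewer
      -- variables suffice. Otherwise the term in fewer variables vanishes and the sum is the
      -- Catalan recursion.
      by_cases hi : matching σ (i, true) = (i, false)
      · rw [ih (by omega) _ _ ((trivialFrom_iff i hσ).2 hi) hk, Finset.sum_eq_zero, add_zero]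
        intro j hj
        have hj' := (Finset.mem_filter.1 hj).2
        have := card_parts_cosetType_swap_mul_le_of_matching_eq σ (x := (i, false)) (y := j)
          (by rintro rfl; exact hj'.false)
          (Or.inl ((congrArg (matching σ) hi).symm.trans (matching_matching_apply σ _)))
        rw [topCoeff, if_neg (by omega)]
      · rw [coeff_completeUpTo_eq_zero _ (by omega) _ _ (mt (trivialFrom_iff i hσ).1 hi), zero_add,
          ← sum_topCoeff_cosetType_swap_mul σ i hi k hk]
        -- The sum extends from indices below `i` to all indices other than `i`: a point of larger
        -- index is still paired with its bar, so its term is 0.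
        refine Finset.sum_subset ?_ ?_
        · intro j hj
          rw [Finset.mem_filter] at hj ⊢
          exact ⟨hj.1, hj.2.ne⟩
        · intro j hj hj'
          rw [Finset.mem_filter] at hj hj'
          have hlt : i < j.1 := lt_of_le_of_ne (not_lt.1 fun h => hj' ⟨hj.1, h⟩) hj.2.symm
          have := card_parts_cosetType_swap_mul_le_of_matching_eq σ (x := (i, false)) (y := j)
            (by rintro rfl; exact hlt.false) (Or.inr (hσ j hlt))
          rw [topCoeff, if_neg (by omega)]

end Coefficients

/-! ### Invariance under $H_n$ and existence of the expansion -/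

section Invariance

variable {n : ℕ}

/-- The elements of the group algebra fixed by left multiplication by the hyperoctahedral group. -/
noncomputable def leftInvariants (n : ℕ) : AddSubgroup (GrpAlg n) where
  carrier := {y | ∀ h ∈ hyperoctahedral n, perm h * y = y}
  zero_mem' := fun h _ => mul_zero _
  add_mem' := fun {a b} ha hb h hh => by rw [mul_add, ha h hh, hb h hh]
  neg_mem' := fun {a} ha h hh => by rw [mul_neg, ha h hh]

theorem mul_mem_leftInvariants {y : GrpAlg n} (hy : y ∈ leftInvariants n) (z : GrpAlg n) :
    y * z ∈ leftInvariants n := fun h hh => by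
  rw [← mul_assoc, hy h hh]

theorem pElt_mem_leftInvariants : pElt n ∈ leftInvariants n := by
  intro h hh
  ext σ
  rw [coeff_perm_mul, coeff_pElt, coeff_pElt, Subgroup.mul_mem_cancel_left _ (inv_mem hh)]

theorem pElt_mul_perm {h : Sym2n n} (hh : h ∈ hyperoctahedral n) : pElt n * perm h = pElt n := by
  ext σ
  rw [coeff_mul_perm, coeff_pElt, coeff_pElt, Subgroup.mul_mem_cancel_right _ (inv_mem hh)]

/-- Here `N` is the order of $H_n$; only its being nonzero is needed, for cancellation over $\mathbb
Z$. -/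
theorem exists_pElt_mul_eq_smul (n : ℕ) : ∃ N : ℤ, N ≠ 0 ∧ ∀ y ∈ leftInvariants n,
    pElt n * y = N • y := by
  classical
  refine ⟨((Finset.univ.filter fun σ : Sym2n n => σ ∈ hyperoctahedral n).card : ℤ), ?_, ?_⟩
  · have : (1 : Sym2n n) ∈ Finset.univ.filter fun σ : Sym2n n => σ ∈ hyperoctahedral n := by
      simp [one_mem]
    exact_mod_cast (Finset.card_pos.2 ⟨_, this⟩).ne'
  · intro y hy
    rw [pElt, Finset.sum_mul, Finset.sum_congr rfl fun σ hσ => hy σ (by simpa using hσ),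
      Finset.sum_const, natCast_zsmul]

/-- With all `n` variables `TrivialFrom` is vacuous, so `coeff_elemUpTo` gives every coefficient in
terms of the coset-type alone. -/
theorem elem_mul_pElt_mem_leftInvariants (k : ℕ) :
    elemUpTo (oddJucysMurphy (n := n)) n k * pElt n ∈ leftInvariants n := by
  have htriv : ∀ σ : Sym2n n, TrivialFrom σ n := fun σ x hx => absurd x.1.2 (not_lt.2 hx)
  intro h hh
  ext σ
  rw [coeff_perm_mul, coeff_elemUpTo n le_rfl k _ (htriv _), coeff_elemUpTo n le_rfl k _ (htriv _),
    cosetType_mul_left _ (inv_mem hh)]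

/-- By $\sum_j (-1)^j h_{k-j}e_j = 0$ it suffices to treat $h_{k-j}e_jp_n$ with $j\ge1$. As $e_jp_n$
is left invariant, $N\,h_{k-j}e_jp_n = (h_{k-j}p_n)(e_jp_n)$, whose left factor is left invariant by
induction; then $N$ is cancelled. -/
theorem complete_mul_pElt_mem_leftInvariants (k : ℕ) :
    completeUpTo (oddJucysMurphy (n := n)) n k * pElt n ∈ leftInvariants n := by
  induction k using Nat.strong_induction_on with
  | _ k ih =>
    cases k with
    | zero => rw [completeUpTo_zero_right, one_mul]; exact pElt_mem_leftInvariants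
    | succ k =>
      have hrel := congrArg (· * pElt n)
        (sum_antidiagonal_completeUpTo_mul_elemUpTo (oddJucysMurphy (n := n)) k)
      simp only [zero_mul] at hrel
      rw [Finset.Nat.sum_antidiagonal_succ', add_mul, elemUpTo_zero_right, pow_zero, mul_one,
        mul_one, Finset.sum_mul] at hrel
      rw [eq_neg_of_add_eq_zero_left hrel]
      refine neg_mem (sum_mem fun p hp => ?_)
      have hp1 : p.1 < k + 1 := by
        have := Finset.HasAntidiagonal.mem_antidiagonal.1 hp
        omega
      obtain ⟨N, hN, hNy⟩ := exists_pElt_mul_eq_smul n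
      have hy : (-1) ^ (p.2 + 1) * elemUpTo (oddJucysMurphy (n := n)) n (p.2 + 1) * pElt n ∈
          leftInvariants n := by
        have := elem_mul_pElt_mem_leftInvariants (n := n) (p.2 + 1)
        rcases neg_one_pow_eq_or (GrpAlg n) (p.2 + 1) with h | h
        · rwa [h, one_mul]
        · rw [h, neg_one_mul, neg_mul]
          exact neg_mem this
      intro h hh
      rw [mul_assoc (completeUpTo _ _ _)]
      have hmem := mul_mem_leftInvariants (ih _ hp1)
        ((-1) ^ (p.2 + 1) * elemUpTo (oddJucysMurphy (n := n)) n (p.2 + 1) * pElt n) h hh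
      rw [mul_assoc (completeUpTo _ _ _) (pElt n), hNy _ hy, mul_smul_comm, mul_smul_comm] at hmem
      ext σ
      have := congrArg (fun y => y.coeff σ) hmem
      simp only [MonoidAlgebra.coeff_smul_apply, smul_eq_mul] at this
      exact mul_left_cancel₀ hN this

theorem coeff_complete_mul_pElt_eq (k : ℕ) {σ τ : Sym2n n} (h : cosetType σ = cosetType τ) :
    (complete k (oddJucysMurphy (n := n)) * pElt n).coeff σ =
      (complete k (oddJucysMurphy (n := n)) * pElt n).coeff τ := by
  obtain ⟨g, hg, g', hg', rfl⟩ := exists_eq_mul_mul_of_cosetType_eq h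
  rw [complete_eq_completeUpTo]
  have h1 := coeff_mul_perm g'⁻¹ (completeUpTo (oddJucysMurphy (n := n)) n k * pElt n) (g * σ)
  rw [mul_assoc, pElt_mul_perm (inv_mem hg'), inv_inv] at h1
  have h2 := coeff_perm_mul g⁻¹ (completeUpTo (oddJucysMurphy (n := n)) n k * pElt n) σ
  rw [complete_mul_pElt_mem_leftInvariants k _ (inv_mem hg), inv_inv] at h2
  rw [h2, h1]

theorem isClassExpansion_iff (k : ℕ) (b : n.Partition → ℤ) : IsClassExpansion n k b ↔
    ∀ σ, b (cosetType σ) = (complete k (oddJucysMurphy (n := n)) * pElt n).coeff σ := by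
  classical
  have hcoeff : ∀ σ : Sym2n n, (∑ μ : n.Partition, b μ • classSum μ).coeff σ =
      b (cosetType σ) := by
    intro σ
    rw [MonoidAlgebra.coeff_sum, Finsupp.finsetSum_apply]
    simp only [MonoidAlgebra.coeff_smul_apply, smul_eq_mul, coeff_classSum, mul_ite, mul_one,
      mul_zero, Finset.sum_ite_eq, Finset.mem_univ, if_true]
  rw [IsClassExpansion]
  constructor
  · intro h σ
    rw [h, hcoeff]
  · intro h
    ext σ
    rw [hcoeff, h]

end Invariance

end OddJM

theorem mainTheorem9 (n k : ℕ) :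
    (∃! b : n.Partition → ℤ, OddJM.IsClassExpansion n k b) ∧
    ∀ b : n.Partition → ℤ, OddJM.IsClassExpansion n k b → ∀ ρ : n.Partition,
      ((k : ℤ) < (n : ℤ) - (Multiset.card ρ.parts : ℤ) → b ρ = 0) ∧
      ((n : ℤ) - (Multiset.card ρ.parts : ℤ) = (k : ℤ) →
        b ρ = (ρ.parts.map fun r => (catalan (r - 1) : ℤ)).prod) := by
  choose s hs using OddJM.exists_cosetType_eq (n := n)
  refine ⟨⟨fun μ => (OddJM.complete k (OddJM.oddJucysMurphy (n := n)) * OddJM.pElt n).coeff (s μ),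
    ?_, ?_⟩, ?_⟩
  · exact (OddJM.isClassExpansion_iff k _).2 fun σ => OddJM.coeff_complete_mul_pElt_eq k (hs _)
  · intro b hb
    funext μ
    rw [← (OddJM.isClassExpansion_iff k b).1 hb, hs]
  · intro b hb ρ
    have key : k + Multiset.card ρ.parts ≤ n → b ρ = OddJM.topCoeff n k ρ.parts := by
      intro hk
      have h1 := (OddJM.isClassExpansion_iff k b).1 hb (s ρ)
      rw [hs, OddJM.complete_eq_completeUpTo, OddJM.coeff_completeUpTo n le_rfl k (s ρ)
        (fun x hx => absurd x.1.2 (not_lt.2 hx)) (by rwa [hs]), hs] at h1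
      exact h1
    constructor
    · intro h
      rw [key (by omega), OddJM.topCoeff, if_neg (by omega)]
    · intro h
      rw [key (by omega), OddJM.topCoeff, if_pos (by omega)]
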